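/- Let $G=(V,E)$ be a finite simple graph with edge weights $w\in\mathbb{R}^E_{\ge 0}$. A fractional matching of $G$ is a vector $x\in\mathbb{R}^E$ with $x\ge 0$ and $x(\delta(v))=\sum_{e\ni v}x_e\le 1$ for all $v\in V$; it is basic if it is a basic feasible solution of this linear system, i.e. an extreme point of its solution set. Write $\nu(G)$ for the maximum weight of a matching of $G$ and $\nu_f(G)$ for the maximum of $\sum_{e\in E} w_ex_e$ over the fractional matchings $x$ of $G$. Call $G$ stable if $\nu(G)=\nu_f(G)$, and call $F\subseteq E$ an edge-stabilizer of $G$ if $G\setminus F:=(V,E\setminus F)$, with the restricted weights, is stable. For a basic fractional matching $x$ let $\mathscr{C}(x)$ be the set of odd cycles $C$ of $G$ with $x_e=\tfrac12$ for all $e\in E(C)$, and let $\gamma(G)$ be the minimum of $|\mathscr{C}(x)|$ over all basic fractional matchings $x$ of weight $\nu_f(G)$. Then: 1. For every edge $e\in E$, $\gamma(G\setminus e)\ge\gamma(G)-2$. 2. For every edge-stabilizer $F$ of $G$, $|F|\ge\lceil\gamma(G)/2\rceil$. 3. The number $\gamma(G)$ is not in general a lower bound on the size of an edge-stabilizer: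 there are a graph $G$ on eight vertices with positive edge weights and an edge $e$ of $G$ such that $\gamma(G)=2$ and $\{e\}$ is an edge-stabilizer of $G$ of minimum cardinality. -/

import Mathlib

namespace WeightedMatching

variable {V : Type*} [Fintype V]

/- Throughout, an edge-weighted graph is a finite simple graph `G` with a weight function
`w : Sym2 V → ℝ` of which only the values on the edges of `G` are used.  A vector of `ℝ^E` is
written as its extension by zero, a function `x : Sym2 V → ℝ` that vanishes off `G.edgeSet`. -/

open Classical in
/-- The weight `∑_{e ∈ E} w_e x_e` of a vector `x`. -/
noncomputable def fracWeight (G : SimpleGraph V) (w x : Sym2 V → ℝ) : ℝ :=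
  ∑ e ∈ G.edgeFinset, w e * x e

open Classical in
/-- The fractional matching polytope
`{x ∈ ℝ^E : x(δ(v)) ≤ 1 for all v ∈ V, x ≥ 0}`. -/
def fracMatchings (G : SimpleGraph V) : Set (Sym2 V → ℝ) :=
  {x | (∀ e, e ∉ G.edgeSet → x e = 0) ∧ (∀ e ∈ G.edgeSet, 0 ≤ x e) ∧
    ∀ v, ∑ e ∈ G.incidenceFinset v, x e ≤ 1}

open Classical in
/-- The weight of the edges of a subgraph. -/
noncomputable def subgraphWeight (G : SimpleGraph V) (w : Sym2 V → ℝ) (M : G.Subgraph) : ℝ :=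
  ∑ e ∈ G.edgeFinset with e ∈ M.edgeSet, w e

/-- `ν(G)`, the value of a maximum-weight matching (a supremum over a finite nonempty set). -/
noncomputable def nu (G : SimpleGraph V) (w : Sym2 V → ℝ) : ℝ :=
  sSup {r | ∃ M : G.Subgraph, M.IsMatching ∧ subgraphWeight G w M = r}

/-- `ν_f(G)`, the value of a maximum-weight fractional matching (the supremum of a linear
function over a nonempty compact set). -/
noncomputable def nuFrac (G : SimpleGraph V) (w : Sym2 V → ℝ) : ℝ :=
  sSup (fracWeight G w '' fracMatchings G)

/-- `G` is stable if a maximum-weight matching and a maximum-weight fractional matching have the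
same value. -/
def IsStable (G : SimpleGraph V) (w : Sym2 V → ℝ) : Prop :=
  nu G w = nuFrac G w

/-- An edge-stabilizer is a set of edges of `G` whose deletion makes `G` stable. -/
def IsEdgeStabilizer (G : SimpleGraph V) (w : Sym2 V → ℝ) (F : Finset (Sym2 V)) : Prop :=
  (F : Set (Sym2 V)) ⊆ G.edgeSet ∧ IsStable (G.deleteEdges (F : Set (Sym2 V))) w

/-- An edge-stabilizer of minimum cardinality. -/
def IsMinEdgeStabilizer (G : SimpleGraph V) (w : Sym2 V → ℝ) (F : Finset (Sym2 V)) : Prop :=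
  IsEdgeStabilizer G w F ∧ ∀ F', IsEdgeStabilizer G w F' → F.card ≤ F'.card

/-- The basic maximum-weight fractional matchings: the basic feasible solutions (the vertices of
the fractional matching polytope) at which the weight is maximum. -/
def basicMaxFracMatchings (G : SimpleGraph V) (w : Sym2 V → ℝ) : Set (Sym2 V → ℝ) :=
  {x | x ∈ Set.extremePoints ℝ (fracMatchings G) ∧
    ∀ x' ∈ fracMatchings G, fracWeight G w x' ≤ fracWeight G w x}

/-- The set `𝒞(x)` of the odd cycles of `G` all of whose edges have value `1/2` in `x`.  A cycle
is taken as a subgraph, so it does not depend on a starting vertex or an orientation. -/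
def oddCycles (G : SimpleGraph V) (x : Sym2 V → ℝ) : Set G.Subgraph :=
  {C | ∃ (v : V) (p : G.Walk v v), p.IsCycle ∧ Odd p.length ∧
    (∀ e ∈ p.edges, x e = 1 / 2) ∧ C = p.toSubgraph}

/-- `γ(G)`, the minimum of `|𝒞(x)|` over the basic maximum-weight fractional matchings `x`. -/
noncomputable def gamma (G : SimpleGraph V) (w : Sym2 V → ℝ) : ℕ :=
  sInf ((fun x => (oddCycles G x).ncard) '' basicMaxFracMatchings G w)

open Classical in
/-- The fractional matching polytope is compact. -/
theorem isCompact_fracMatchings (G : SimpleGraph V) : IsCompact (fracMatchings G) := by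
  have hsub : fracMatchings G ⊆ Set.Icc (fun _ => (0 : ℝ)) (fun _ => 1) := by
    rintro x ⟨h0, hn, h1⟩
    have hn' : ∀ e, 0 ≤ x e := fun e => by
      by_cases he : e ∈ G.edgeSet
      · exact hn e he
      · exact (h0 e he).ge
    refine ⟨hn', fun e => ?_⟩
    by_cases he : e ∈ G.edgeSet
    · induction e with
      | _ a b =>
        refine le_trans ?_ (h1 a)
        refine Finset.single_le_sum (f := x) (fun i _ => hn' i) ?_
        rw [SimpleGraph.mem_incidenceFinset]
        exact ⟨he, Sym2.mem_mk_left a b⟩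
    · rw [h0 e he]; exact zero_le_one
  refine isCompact_Icc.of_isClosed_subset ?_ hsub
  simp only [fracMatchings, Set.ofPred_and, Set.ofPred_forall]
  refine IsClosed.inter ?_ (IsClosed.inter ?_ ?_)
  · exact isClosed_iInter fun e => isClosed_iInter fun _ =>
      isClosed_eq (continuous_apply e) continuous_const
  · exact isClosed_iInter fun e => isClosed_iInter fun _ =>
      isClosed_le continuous_const (continuous_apply e)
  · exact isClosed_iInter fun v => isClosed_le
      (continuous_finsetSum _ fun e _ => continuous_apply e) continuous_const

/-- A basic maximum-weight fractional matching exists, so the minimum that defines `γ` is taken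
over a nonempty set. -/
theorem basicMaxFracMatchings_nonempty (G : SimpleGraph V) (w : Sym2 V → ℝ) :
    (basicMaxFracMatchings G w).Nonempty := by
  classical
  let l : StrongDual ℝ (Sym2 V → ℝ) :=
    ∑ e ∈ G.edgeFinset, w e • ContinuousLinearMap.proj e
  have hl : ∀ x, l x = fracWeight G w x := by
    intro x
    simp [l, fracWeight]
  have hne : (fracMatchings G).Nonempty := ⟨0, by simp [fracMatchings]⟩
  obtain ⟨x, hx, hmax⟩ :=
    (isCompact_fracMatchings G).exists_isMaxOn hne l.continuous.continuousOn
  have hexp : IsExposed ℝ (fracMatchings G) (l.toExposed (fracMatchings G)) :=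
    ContinuousLinearMap.toExposed.isExposed
  obtain ⟨z, hz⟩ := (hexp.isCompact (isCompact_fracMatchings G)).extremePoints_nonempty
    ⟨x, hx, fun y hy => hmax hy⟩
  refine ⟨z, hexp.isExtreme.extremePoints_subset_extremePoints hz, fun y hy => ?_⟩
  rw [← hl, ← hl]
  exact hz.1.2 y hy

end WeightedMatching

/-! The proof turns `γ(G)` into a matching defect. Fix an optimal dual solution `y`, let `B` be the
set of vertices with `y > 0`, and call an edge tight if its weight equals the sum of `y` at its
ends. By Birkhoff's theorem every basic fractional matching has the form `permVec σ`, where the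
permutation `σ` moves vertices only along edges: 2-cycles give value 1, longer cycles give value
1/2. By complementary slackness such a vector is optimal exactly when `σ` moves along tight edges
and fixes no point of `B`.

The core is that, for every optimal `y`, `γ(G)` is the least number of vertices of `B` missed by a
matching of tight edges. For one inequality, each odd cycle of an optimal basic vector is replaced
by a matching along it that misses one vertex (`IsOptDual.exists_matching_le_gamma`). For the other,
a matching that misses `k` vertices of `B` is augmented along a permutation covering `B`; each
missed vertex is either absorbed or traded for an odd cycle (`exists_isOddCover_of_involution`,
`IsOptDual.gamma_le`).

A graph and the graph without the edges at `v` share an optimal dual away from `v`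
(`exists_common_isOptDual`), so isolating a vertex changes `γ` by at most one in either direction.
Isolating an end of `e` gives the same graph from `G` as from `G \ e`; hence deleting `e` lowers `γ`
by at most two. A stable graph has `γ = 0`, and the bound on stabilizers follows by induction on
`F`. The example is two heavy triangles joined by a light path whose middle edge is deleted. -/

namespace WeightedMatching

/-! ### Linear programming duality by separation. -/

section Duality

/-- Strong linear programming duality for `max c x`, `x ≥ 0`, `x A ≤ 1`. -/
theorem exists_dual_of_forall_le {I J : Type*} [Fintype I] [Fintype J] (A : I → J → ℝ)
    (c : I → ℝ) (θ : ℝ)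
    (h : ∀ x : I → ℝ, (∀ i, 0 ≤ x i) → (∀ j, ∑ i, x i * A i j ≤ 1) → ∑ i, c i * x i ≤ θ) :
    ∃ y : J → ℝ, (∀ j, 0 ≤ y j) ∧ ∑ j, y j ≤ θ ∧ ∀ i, c i ≤ ∑ j, A i j * y j := by
  classical
  -- Pairs of a right-hand side and a value that some `x` beats strictly. Strictness makes `S` open,
  -- so the point `(1, θ)` can be separated from it without a closedness argument for cones.
  let S : Set ((J → ℝ) × ℝ) := {p | ∃ x : I → ℝ, (∀ i, 0 ≤ x i) ∧
    (∀ j, ∑ i, x i * A i j < p.1 j) ∧ p.2 < ∑ i, c i * x i}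
  have hconv : Convex ℝ S := by
    rintro p ⟨x, hx0, hx1, hx2⟩ q ⟨z, hz0, hz1, hz2⟩ s t hs ht hst
    refine ⟨fun i => s * x i + t * z i, fun i => by
      have := hx0 i; have := hz0 i; positivity, fun j => ?_, ?_⟩
    · have e : ∑ i, (s * x i + t * z i) * A i j =
          s * ∑ i, x i * A i j + t * ∑ i, z i * A i j := by
        rw [Finset.mul_sum, Finset.mul_sum, ← Finset.sum_add_distrib]
        exact Finset.sum_congr rfl fun i _ => by ring
      rw [e]
      simp only [Prod.fst_add, Prod.smul_fst, Pi.add_apply, Pi.smul_apply, smul_eq_mul]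
      rcases hs.eq_or_lt with rfl | hs'
      · have ht' : t = 1 := by linarith
        subst ht'; simpa using hz1 j
      · nlinarith [mul_lt_mul_of_pos_left (hx1 j) hs', mul_le_mul_of_nonneg_left (hz1 j).le ht]
    · have e : ∑ i, c i * (s * x i + t * z i) =
          s * ∑ i, c i * x i + t * ∑ i, c i * z i := by
        rw [Finset.mul_sum, Finset.mul_sum, ← Finset.sum_add_distrib]
        exact Finset.sum_congr rfl fun i _ => by ring
      rw [e]
      simp only [Prod.snd_add, Prod.smul_snd, smul_eq_mul]
      rcases hs.eq_or_lt with rfl | hs'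
      · have ht' : t = 1 := by linarith
        subst ht'; simpa using hz2
      · nlinarith [mul_lt_mul_of_pos_left hx2 hs', mul_le_mul_of_nonneg_left hz2.le ht]
  have hopen : IsOpen S := by
    have : S = ⋃ x : I → ℝ, ⋃ _ : ∀ i, 0 ≤ x i,
        ((⋂ j, {p : (J → ℝ) × ℝ | ∑ i, x i * A i j < p.1 j}) ∩
          {p : (J → ℝ) × ℝ | p.2 < ∑ i, c i * x i}) := by
      ext p
      simp only [S, Set.mem_ofPred_eq, Set.mem_iUnion, Set.mem_inter_iff, Set.mem_iInter, exists_prop]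
    rw [this]
    refine isOpen_iUnion fun x => isOpen_iUnion fun _ => IsOpen.inter ?_ ?_
    · exact isOpen_iInter_of_finite fun j => isOpen_lt continuous_const (by fun_prop)
    · exact isOpen_lt (by fun_prop) continuous_const
  have hnot : ((fun _ => 1, θ) : (J → ℝ) × ℝ) ∉ S := by
    rintro ⟨x, hx0, hx1, hx2⟩
    exact absurd (h x hx0 fun j => (hx1 j).le) (not_le.2 hx2)
  obtain ⟨f, hf⟩ := geometric_hahn_banach_open_point hconv hopen hnot
  set q : ℝ := f (0, 1) with hq
  set p : J → ℝ := fun j => f (Pi.single j 1, 0) with hp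
  have hfval : ∀ b r, f (b, r) = ∑ j, b j * p j + r * q := by
    intro b r
    have e : ((b, r) : (J → ℝ) × ℝ) =
        ∑ j, b j • ((Pi.single j 1, 0) : (J → ℝ) × ℝ) + r • ((0, 1) : (J → ℝ) × ℝ) := by
      ext j
      · simp [Prod.fst_sum, Finset.sum_apply, Pi.single_apply]
      · simp [Prod.snd_sum]
    rw [e, map_add, map_sum]
    simp only [map_smul, smul_eq_mul, hp, hq]
  have hlt : ∀ (x : I → ℝ) (b : J → ℝ) (r : ℝ), (∀ i, 0 ≤ x i) →
      (∀ j, ∑ i, x i * A i j < b j) → r < ∑ i, c i * x i →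
      ∑ j, b j * p j + r * q < ∑ j, p j + θ * q := by
    intro x b r h0 h1 h2
    have := hf (b, r) ⟨x, h0, h1, h2⟩
    rw [hfval, hfval] at this
    simpa using this
  have hle : ∀ (x : I → ℝ) (b : J → ℝ) (r : ℝ), (∀ i, 0 ≤ x i) →
      (∀ j, ∑ i, x i * A i j ≤ b j) → r ≤ ∑ i, c i * x i →
      ∑ j, b j * p j + r * q ≤ ∑ j, p j + θ * q := by
    intro x b r h0 h1 h2
    by_contra! hcon
    -- Shifting `b` up and `r` down by `ε` restores the strict inequalities; a small `ε` keeps the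
    -- assumed violation.
    have hK : ∃ ε > 0, ε * (∑ j, p j - q) > (∑ j, p j + θ * q) - (∑ j, b j * p j + r * q) := by
      set K := ∑ j, p j - q
      set δ := (∑ j, b j * p j + r * q) - (∑ j, p j + θ * q) with hδ
      have hδ0 : 0 < δ := by linarith
      refine ⟨δ / (2 * (|K| + 1)), by positivity, ?_⟩
      have h3 : δ / (2 * (|K| + 1)) * |K| ≤ δ / 2 := by
        rw [div_mul_eq_mul_div, div_le_div_iff₀ (by positivity) (by norm_num)]
        nlinarith [abs_nonneg K]
      have h4 := mul_le_mul_of_nonneg_left (neg_abs_le K)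
        (show 0 ≤ δ / (2 * (|K| + 1)) by positivity)
      linarith
    obtain ⟨ε, hε, hK⟩ := hK
    have h5 := hlt x (fun j => b j + ε) (r - ε) h0 (fun j => by linarith [h1 j]) (by linarith)
    simp only [add_mul, Finset.sum_add_distrib, ← Finset.mul_sum] at h5
    nlinarith
  have hq0 : 0 < q := by
    have h1 := hlt (fun _ => 0) (fun _ => 1) (min (-1) (θ - 1)) (by simp) (by simp) (by simp)
    have h2 : min (-1) (θ - 1) ≤ θ - 1 := min_le_right _ _
    simp only [one_mul] at h1
    by_contra! hcon
    nlinarith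
  have hp0 : ∀ j, p j ≤ 0 := by
    intro j
    by_contra! hcon
    set M := (|θ| * q + 1 + |∑ j, p j|) / p j with hM
    have hMp : M * p j = |θ| * q + 1 + |∑ j, p j| := by rw [hM]; field_simp
    have hM0 : 0 ≤ M := by positivity
    have := hle (fun _ => 0) (Pi.single j M) 0 (by simp)
      (fun k => by
        rcases eq_or_ne k j with rfl | hk
        · simpa using hM0
        · simp [hk]) (by simp)
    have e : ∑ k, (Pi.single j M : J → ℝ) k * p k = M * p j := by
      simp [Pi.single_apply]
    rw [e, hMp] at this
    nlinarith [le_abs_self θ, le_abs_self (∑ j, p j), abs_nonneg (∑ j, p j)]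
  -- The dual solution is the separating functional, normalized so that the value has coefficient
  -- one.
  refine ⟨fun j => -p j / q, fun j => div_nonneg (by linarith [hp0 j]) hq0.le, ?_, fun i => ?_⟩
  · have := hle (fun _ => 0) (fun _ => 0) 0 (by simp) (by simp) (by simp)
    rw [← Finset.sum_div, div_le_iff₀ hq0, Finset.sum_neg_distrib]
    simp at this
    linarith
  · have hi : ∀ t : ℝ, 0 ≤ t → t * (∑ j, A i j * p j + c i * q) ≤ ∑ j, p j + θ * q := by
      intro t ht
      have h6 := hle (Pi.single i t) (fun j => t * A i j) (t * c i)
        (fun k => by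
          rcases eq_or_ne k i with rfl | hk
          · simpa using ht
          · simp [hk]) (fun j => by simp [Pi.single_apply])
          (by simp [Pi.single_apply, mul_comm])
      have e : ∑ j, t * A i j * p j = t * ∑ j, A i j * p j := by
        rw [Finset.mul_sum]; exact Finset.sum_congr rfl fun j _ => by ring
      rw [e] at h6
      linarith
    have h7 : ∑ j, A i j * p j + c i * q ≤ 0 := by
      by_contra! hcon
      set D := ∑ j, A i j * p j + c i * q
      have := hi ((|∑ j, p j + θ * q| + 1) / D) (by positivity)
      rw [div_mul_cancel₀ _ hcon.ne'] at this
      linarith [le_abs_self (∑ j, p j + θ * q)]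
    have e : ∑ j, A i j * (-p j / q) = -(∑ j, A i j * p j) / q := by
      rw [neg_div, Finset.sum_div, ← Finset.sum_neg_distrib]
      exact Finset.sum_congr rfl fun j _ => by ring
    rw [e, le_div_iff₀ hq0]
    linarith

end Duality

/-! ### Sums over edges as sums over ordered pairs of vertices. -/

section EdgeSums

variable {V : Type*} [Fintype V]

open Classical in
theorem sum_incidenceFinset (G : SimpleGraph V) {x : Sym2 V → ℝ} (hx : ∀ e, e ∉ G.edgeSet → x e = 0)
    (v : V) : ∑ e ∈ G.incidenceFinset v, x e = ∑ u, x s(v, u) := by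
  have h1 : G.incidenceFinset v = (G.neighborFinset v).image (fun u => s(v, u)) := by
    ext e
    induction e with
    | _ a b =>
      simp only [SimpleGraph.mem_incidenceFinset, SimpleGraph.mk'_mem_incidenceSet_iff,
        Finset.mem_image, SimpleGraph.mem_neighborFinset]
      constructor
      · rintro ⟨hab, rfl | rfl⟩
        · exact ⟨b, hab, rfl⟩
        · exact ⟨a, hab.symm, Sym2.eq_swap⟩
      · rintro ⟨u, hu, he⟩
        rcases Sym2.eq_iff.1 he with ⟨rfl, rfl⟩ | ⟨rfl, rfl⟩
        · exact ⟨hu, Or.inl rfl⟩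
        · exact ⟨hu.symm, Or.inr rfl⟩
  rw [h1, Finset.sum_image (fun a _ b _ h => Sym2.congr_right.1 h)]
  refine Finset.sum_subset (Finset.subset_univ _) fun u _ hu => hx _ ?_
  rwa [SimpleGraph.mem_neighborFinset] at hu

open Classical in
theorem two_mul_sum_edgeFinset (G : SimpleGraph V) {x : Sym2 V → ℝ}
    (hx : ∀ e, e ∉ G.edgeSet → x e = 0) :
    2 * ∑ e ∈ G.edgeFinset, x e = ∑ u, ∑ v, x s(u, v) := by
  have h1 : ∀ u, ∑ v, x s(u, v) = ∑ e ∈ G.edgeFinset, if u ∈ e then x e else 0 := by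
    intro u
    rw [← sum_incidenceFinset G hx, SimpleGraph.incidenceFinset_eq_filter, Finset.sum_filter]
  simp_rw [h1]
  rw [Finset.sum_comm, Finset.mul_sum]
  refine Finset.sum_congr rfl fun e he => ?_
  induction e with
  | _ a b =>
    have hab : a ≠ b := by
      rw [SimpleGraph.mem_edgeFinset, SimpleGraph.mem_edgeSet] at he
      exact he.ne
    rw [← Finset.sum_filter]
    have : Finset.univ.filter (fun u => u ∈ s(a, b)) = {a, b} := by ext; simp
    rw [this, Finset.sum_pair hab]
    ring

theorem mem_fracMatchings_iff (G : SimpleGraph V) (x : Sym2 V → ℝ) :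
    x ∈ fracMatchings G ↔ (∀ e, e ∉ G.edgeSet → x e = 0) ∧ (∀ e, 0 ≤ x e) ∧
      ∀ v, ∑ u, x s(v, u) ≤ 1 := by
  constructor
  · rintro ⟨h0, h1, h2⟩
    refine ⟨h0, fun e => ?_, fun v => ?_⟩
    · by_cases he : e ∈ G.edgeSet
      · exact h1 e he
      · exact (h0 e he).ge
    · rw [← sum_incidenceFinset G h0]; exact h2 v
  · rintro ⟨h0, h1, h2⟩
    refine ⟨h0, fun e _ => h1 e, fun v => ?_⟩
    rw [sum_incidenceFinset G h0]; exact h2 v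

theorem two_mul_fracWeight (G : SimpleGraph V) (w : Sym2 V → ℝ) {x : Sym2 V → ℝ}
    (hx : ∀ e, e ∉ G.edgeSet → x e = 0) :
    2 * fracWeight G w x = ∑ u, ∑ v, w s(u, v) * x s(u, v) := by
  classical
  exact two_mul_sum_edgeFinset G (x := fun e => w e * x e) fun e he => by simp [hx e he]

theorem fracWeight_eq_of_le {G H : SimpleGraph V} (w : Sym2 V → ℝ) {x : Sym2 V → ℝ} (hGH : G ≤ H)
    (hx : ∀ e, e ∉ G.edgeSet → x e = 0) : fracWeight H w x = fracWeight G w x := by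
  have h1 := two_mul_fracWeight G w hx
  have h2 := two_mul_fracWeight H w (x := x) fun e he =>
    hx e fun h => he (SimpleGraph.edgeSet_mono hGH h)
  linarith

/-- The gap between the value of a dual vector `y` and the weight of `x` is a sum of
complementarity terms. -/
theorem sum_sub_fracWeight (G : SimpleGraph V) (w : Sym2 V → ℝ) {x : Sym2 V → ℝ}
    (hx : ∀ e, e ∉ G.edgeSet → x e = 0) (y : V → ℝ) :
    2 * (∑ v, y v - fracWeight G w x) = 2 * ∑ u, y u * (1 - ∑ v, x s(u, v)) +
      ∑ u, ∑ v, (y u + y v - w s(u, v)) * x s(u, v) := by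
  have h1 := two_mul_fracWeight G w hx
  have h2 : ∑ u, ∑ v, y v * x s(u, v) = ∑ u, ∑ v, y u * x s(u, v) := by
    rw [Finset.sum_comm]
    exact Finset.sum_congr rfl fun u _ => Finset.sum_congr rfl fun v _ => by rw [Sym2.eq_swap]
  simp only [sub_mul, add_mul, mul_sub, mul_one, Finset.sum_sub_distrib, Finset.sum_add_distrib,
    Finset.mul_sum, h2] at h1 ⊢
  simp only [← Finset.mul_sum] at h1 ⊢
  linarith

end EdgeSums

/-! ### Birkhoff's theorem and half-integrality. -/

section Permutations

variable {V : Type*}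

open Classical in
/-- The half-integral vector that gives each edge half the number of times a permutation moves
one of its ends to the other. -/
noncomputable def permVec (σ : Equiv.Perm V) : Sym2 V → ℝ :=
  Sym2.lift ⟨fun u v => if u = v then 0 else
    ((if σ u = v then 1 else 0) + (if σ v = u then 1 else 0)) / 2, fun u v => by
      simp only [eq_comm (a := u) (b := v)]
      split_ifs <;> simp⟩

open Classical in
theorem permVec_mk (σ : Equiv.Perm V) (u v : V) : permVec σ s(u, v) = if u = v then 0 else
    ((if σ u = v then 1 else 0) + (if σ v = u then 1 else 0)) / 2 := rfl

theorem permVec_nonneg (σ : Equiv.Perm V) (e : Sym2 V) : 0 ≤ permVec σ e := by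
  induction e with
  | _ a b => rw [permVec_mk]; split_ifs <;> norm_num

/-- The permutation moves every vertex along an edge or fixes it. -/
def MovesAlong (G : SimpleGraph V) (σ : Equiv.Perm V) : Prop :=
  ∀ u, σ u = u ∨ G.Adj u (σ u)

theorem permVec_eq_zero {G : SimpleGraph V} {σ : Equiv.Perm V} (hσ : MovesAlong G σ)
    {e : Sym2 V} (he : e ∉ G.edgeSet) : permVec σ e = 0 := by
  induction e with
  | _ a b =>
    rw [SimpleGraph.mem_edgeSet] at he
    rw [permVec_mk]
    split_ifs with h1 h2 h3 h3
    · rfl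
    all_goals first
      | (exfalso; rcases hσ a with h | h <;> grind [SimpleGraph.adj_comm])
      | (exfalso; rcases hσ b with h | h <;> grind [SimpleGraph.adj_comm])
      | norm_num

variable [Fintype V]

open Classical in
theorem sum_permVec (σ : Equiv.Perm V) (u : V) :
    ∑ v, permVec σ s(u, v) = if σ u = u then 0 else 1 := by
  -- The image and the preimage of `u` contribute one half each; the subtracted terms remove the
  -- diagonal, which matters only if `u` is fixed.
  have h1 : ∀ v, permVec σ s(u, v) = ((if σ u = v then 1 else 0) - (if u = v then
      (if σ u = u then (1 : ℝ) else 0) else 0)) / 2 +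
      ((if σ.symm u = v then 1 else 0) - (if u = v then
      (if σ u = u then (1 : ℝ) else 0) else 0)) / 2 := by
    intro v
    rw [permVec_mk]
    have : σ v = u ↔ σ.symm u = v := by rw [Equiv.symm_apply_eq, eq_comm]
    simp only [this]
    have h2 : σ.symm u = u ↔ σ u = u := by rw [Equiv.symm_apply_eq, eq_comm]
    by_cases huv : u = v
    · subst huv
      by_cases h : σ u = u <;> simp [h, h2]
    · simp [huv]
      ring
  simp_rw [h1]
  rw [Finset.sum_add_distrib, ← Finset.sum_div, ← Finset.sum_div]
  simp only [Finset.sum_sub_distrib, Finset.sum_ite_eq, Finset.mem_univ, if_true]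
  split_ifs <;> norm_num

theorem permVec_mem_fracMatchings {G : SimpleGraph V} {σ : Equiv.Perm V} (hσ : MovesAlong G σ) :
    permVec σ ∈ fracMatchings G := by
  rw [mem_fracMatchings_iff]
  refine ⟨fun e he => permVec_eq_zero hσ he, permVec_nonneg σ, fun v => ?_⟩
  rw [sum_permVec]
  split_ifs <;> norm_num

open Classical in
/-- Birkhoff's theorem, symmetrized: every fractional matching is a convex combination of vectors
of permutations that move along edges. -/
theorem fracMatchings_subset_convexHull (G : SimpleGraph V) :
    fracMatchings G ⊆ convexHull ℝ (permVec '' {σ | MovesAlong G σ}) := by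
  intro x hx
  rw [mem_fracMatchings_iff] at hx
  obtain ⟨h0, h1, h2⟩ := hx
  -- The slack of each degree constraint goes on the diagonal, which makes the symmetric matrix
  -- doubly stochastic; fixed points of permutations stand for slack.
  let X : Matrix V V ℝ := fun u v => x s(u, v) + if u = v then 1 - ∑ t, x s(u, t) else 0
  have hdiag : ∀ u, x s(u, u) = 0 := fun u => h0 _ (by simp)
  have hrow : ∀ u, ∑ v, X u v = 1 := by
    intro u
    simp only [X, Finset.sum_add_distrib, Finset.sum_ite_eq, Finset.mem_univ, if_true]
    ring
  have hsymm : ∀ u v, X u v = X v u := by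
    intro u v
    simp only [X]
    rw [Sym2.eq_swap]
    by_cases h : u = v
    · subst h; rfl
    · simp [h, Ne.symm h]
  have hX : X ∈ doublyStochastic ℝ V := by
    rw [mem_doublyStochastic_iff_sum]
    refine ⟨fun u v => ?_, hrow, fun v => ?_⟩
    · simp only [X]
      have := h1 s(u, v)
      split_ifs
      · linarith [h2 u]
      · linarith
    · rw [← hrow v]
      exact Finset.sum_congr rfl fun u _ => hsymm u v
  obtain ⟨c, hc0, hc1, hcX⟩ := exists_eq_sum_perm_of_mem_doublyStochastic hX
  have hXv : ∀ u v, X u v = ∑ σ : Equiv.Perm V, c σ * if σ u = v then 1 else 0 := by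
    intro u v
    rw [← hcX, Matrix.sum_apply]
    refine Finset.sum_congr rfl fun σ _ => ?_
    simp [Equiv.Perm.permMatrix, PEquiv.toMatrix_apply, Equiv.toPEquiv_apply]
  have hmov : ∀ σ, c σ ≠ 0 → MovesAlong G σ := by
    intro σ hσ u
    by_contra! hcon
    have h3 : X u (σ u) = 0 := by
      simp only [X, if_neg (Ne.symm hcon.1), add_zero]
      exact h0 _ hcon.2
    rw [hXv, Finset.sum_eq_zero_iff_of_nonneg
      (fun τ _ => mul_nonneg (hc0 τ) (by split_ifs <;> norm_num))] at h3
    have := h3 σ (Finset.mem_univ _)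
    simp at this
    exact hσ this
  have hxe : x = ∑ σ : Equiv.Perm V, c σ • permVec σ := by
    ext e
    induction e with
    | _ u v =>
      simp only [Finset.sum_apply, Pi.smul_apply, smul_eq_mul, permVec_mk]
      by_cases h : u = v
      · subst h; simp [hdiag]
      · have h4 : x s(u, v) = (X u v + X v u) / 2 := by
          rw [← hsymm u v]; simp [X, h]
        rw [h4, hXv, hXv, ← Finset.sum_add_distrib, Finset.sum_div]
        refine Finset.sum_congr rfl fun σ _ => ?_
        rw [if_neg h]; ring
  have hsum : ∑ σ ∈ Finset.univ.filter (fun σ => c σ ≠ 0), c σ = 1 := by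
    rw [Finset.sum_filter_ne_zero, hc1]
  have hx2 : x = ∑ σ ∈ Finset.univ.filter (fun σ => c σ ≠ 0), c σ • permVec σ := by
    rw [hxe]
    refine (Finset.sum_subset (Finset.filter_subset _ _) fun σ _ h => ?_).symm
    have : c σ = 0 := by simpa using h
    simp [this]
  rw [hx2]
  refine (convex_convexHull ℝ _).sum_mem (fun σ _ => hc0 σ) hsum fun σ hσ => ?_
  exact subset_convexHull _ _ ⟨σ, hmov σ (by simpa using hσ), rfl⟩

theorem convex_fracMatchings (G : SimpleGraph V) : Convex ℝ (fracMatchings G) := by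
  intro x hx z hz s t hs ht hst
  rw [mem_fracMatchings_iff] at hx hz ⊢
  refine ⟨fun e he => by simp [hx.1 e he, hz.1 e he], fun e => ?_, fun v => ?_⟩
  · have := hx.2.1 e
    have := hz.2.1 e
    simp only [Pi.add_apply, Pi.smul_apply, smul_eq_mul]
    positivity
  · simp only [Pi.add_apply, Pi.smul_apply, smul_eq_mul, Finset.sum_add_distrib, ← Finset.mul_sum]
    nlinarith [hx.2.2 v, hz.2.2 v]

/-- Extreme points of a convex hull lie in the generating set. Not every generator is extreme: a
cycle of even length at least four is the average of two matchings. -/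
theorem exists_perm_of_mem_extremePoints {G : SimpleGraph V} {x : Sym2 V → ℝ}
    (hx : x ∈ Set.extremePoints ℝ (fracMatchings G)) :
    ∃ σ, MovesAlong G σ ∧ x = permVec σ := by
  have h : fracMatchings G = convexHull ℝ (permVec '' {σ | MovesAlong G σ}) := by
    refine (fracMatchings_subset_convexHull G).antisymm (convexHull_min ?_ (convex_fracMatchings G))
    rintro _ ⟨σ, hσ, rfl⟩
    exact permVec_mem_fracMatchings hσ
  rw [h] at hx
  obtain ⟨σ, hσ, rfl⟩ := extremePoints_convexHull_subset hx
  exact ⟨σ, hσ, rfl⟩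

end Permutations

/-! ### Replacing cycles of a permutation by matchings. -/

section PermSurgery

variable {V : Type*}

theorem iterate_eq_of_eq_off {τ τ' : Equiv.Perm V} {S : Set V} (hS : ∀ u ∉ S, τ u ∉ S)
    (h : ∀ u ∉ S, τ' u = τ u) {u : V} (hu : u ∉ S) (n : ℕ) :
    τ'^[n] u = τ^[n] u ∧ τ^[n] u ∉ S := by
  induction n with
  | zero => exact ⟨rfl, hu⟩
  | succ n ih =>
    rw [Function.iterate_succ_apply', Function.iterate_succ_apply', ih.1]
    exact ⟨h _ ih.2, hS _ ih.2⟩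

theorem exists_pairing (a : ℕ → V) (n : ℕ) (ha : Set.InjOn a (Set.Iio (2 * n))) :
    ∃ f : V → V, (∀ j < n, f (a (2 * j)) = a (2 * j + 1) ∧ f (a (2 * j + 1)) = a (2 * j)) ∧
      ∀ u, (∀ i < 2 * n, u ≠ a i) → f u = u := by
  classical
  induction n with
  | zero => exact ⟨id, by simp, fun _ _ => rfl⟩
  | succ n ih =>
    obtain ⟨f, hf1, hf2⟩ := ih (ha.mono (Set.Iio_subset_Iio (by lia)))
    have hne : ∀ i j, i < 2 * (n + 1) → j < 2 * (n + 1) → i ≠ j → a i ≠ a j :=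
      fun i j hi hj hij h => hij (ha hi hj h)
    refine ⟨Function.update (Function.update f (a (2 * n)) (a (2 * n + 1))) (a (2 * n + 1))
      (a (2 * n)), fun j hj => ?_, fun u hu => ?_⟩
    · rcases (Nat.lt_succ_iff_lt_or_eq.1 hj) with hj' | rfl
      · rw [Function.update_of_ne (hne _ _ (by lia) (by lia) (by lia)),
          Function.update_of_ne (hne _ _ (by lia) (by lia) (by lia)),
          Function.update_of_ne (hne _ _ (by lia) (by lia) (by lia)),
          Function.update_of_ne (hne _ _ (by lia) (by lia) (by lia))]
        exact hf1 j hj'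
      · rw [Function.update_of_ne (hne _ _ (by lia) (by lia) (by lia))]
        simp
    · rw [Function.update_of_ne (hu _ (by lia)), Function.update_of_ne (hu _ (by lia))]
      exact hf2 u fun i hi => hu i (by lia)

variable [Fintype V]

/-- By finiteness an injection of `S` into itself is onto `S`, so no point outside can enter it. -/
theorem notMem_of_mapsTo {τ : Equiv.Perm V} {S : Set V} (hS : ∀ u ∈ S, τ u ∈ S) :
    ∀ u ∉ S, τ u ∉ S := by
  intro u hu hτ
  have h : τ '' S = S := by
    refine Set.eq_of_subset_of_ncard_le ?_ ?_ (Set.toFinite _)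
    · rintro _ ⟨v, hv, rfl⟩; exact hS v hv
    · rw [Set.ncard_image_of_injective _ τ.injective]
  rw [← h] at hτ
  obtain ⟨v, hv, hvu⟩ := hτ
  exact hu (τ.injective hvu ▸ hv)

open Classical in
theorem exists_glue (τ : Equiv.Perm V) (f : V → V) (S : Set V) (hS : ∀ u ∈ S, τ u ∈ S)
    (hf : ∀ u ∈ S, f u ∈ S) (hinj : Set.InjOn f S) :
    ∃ τ' : Equiv.Perm V, (∀ u ∈ S, τ' u = f u) ∧ ∀ u ∉ S, τ' u = τ u := by
  have hS' := notMem_of_mapsTo hS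
  have : Function.Injective fun u => if u ∈ S then f u else τ u := by
    intro u v huv
    by_cases hu : u ∈ S <;> by_cases hv : v ∈ S <;> simp only [hu, hv, if_true, if_false] at huv
    · exact hinj hu hv huv
    · exact absurd (huv ▸ hf u hu) (hS' v hv)
    · exact absurd (huv ▸ hf v hv) (hS' u hu)
    · exact τ.injective huv
  refine ⟨Equiv.ofBijective _ (Finite.injective_iff_bijective.1 this), fun u hu => ?_,
    fun u hu => ?_⟩
  · simp [hu]
  · simp [hu]

/-- The forward orbit of a point. -/
def orb (τ : Equiv.Perm V) (c : V) : Set V := {u | ∃ i, τ^[i] c = u}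

omit [Fintype V] in
theorem self_mem_orb (τ : Equiv.Perm V) (c : V) : c ∈ orb τ c := ⟨0, rfl⟩

omit [Fintype V] in
theorem apply_mem_orb {τ : Equiv.Perm V} {c u : V} (hu : u ∈ orb τ c) : τ u ∈ orb τ c := by
  obtain ⟨i, rfl⟩ := hu
  exact ⟨i + 1, Function.iterate_succ_apply' _ _ _⟩

theorem minimalPeriod_pos (τ : Equiv.Perm V) (c : V) : 0 < Function.minimalPeriod τ c :=
  Function.minimalPeriod_pos_of_mem_periodicPts (τ.injective.mem_periodicPts c)

theorem exists_lt_of_mem_orb {τ : Equiv.Perm V} {c u : V} (hu : u ∈ orb τ c) :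
    ∃ i < Function.minimalPeriod τ c, τ^[i] c = u := by
  obtain ⟨i, rfl⟩ := hu
  exact ⟨i % Function.minimalPeriod τ c, Nat.mod_lt _ (minimalPeriod_pos τ c),
    Function.iterate_mod_minimalPeriod_eq⟩

theorem orb_symm {τ : Equiv.Perm V} {c u : V} (hu : u ∈ orb τ c) : c ∈ orb τ u := by
  obtain ⟨i, hi, rfl⟩ := exists_lt_of_mem_orb hu
  refine ⟨Function.minimalPeriod τ c - i, ?_⟩
  rw [← Function.iterate_add_apply, Nat.sub_add_cancel hi.le, Function.iterate_minimalPeriod]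

omit [Fintype V] in
theorem orb_trans {τ : Equiv.Perm V} {a b c : V} (h1 : b ∈ orb τ a) (h2 : c ∈ orb τ b) :
    c ∈ orb τ a := by
  obtain ⟨i, rfl⟩ := h1
  obtain ⟨j, rfl⟩ := h2
  exact ⟨j + i, Function.iterate_add_apply _ _ _ _⟩

omit [Fintype V] in
theorem odd_minimalPeriod {τ : Equiv.Perm V} {c : V} {n : ℕ} (hn : Odd n) (h : τ^[n] c = c) :
    Odd (Function.minimalPeriod τ c) :=
  Odd.of_dvd_nat hn (Function.IsPeriodicPt.minimalPeriod_dvd h)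

omit [Fintype V] in
theorem iterate_eq_self_of_mem_orb {τ : Equiv.Perm V} {c u : V} {n : ℕ} (h : τ^[n] c = c)
    (hu : u ∈ orb τ c) : τ^[n] u = u := by
  obtain ⟨i, rfl⟩ := hu
  rw [← Function.iterate_add_apply, add_comm, Function.iterate_add_apply, h]

omit [Fintype V] in
theorem apply_apply_ne_of_mem_orb {τ : Equiv.Perm V} {c u : V} (h : τ (τ c) ≠ c)
    (hu : u ∈ orb τ c) : τ (τ u) ≠ u := by
  obtain ⟨i, rfl⟩ := hu
  have h1 : τ (τ (τ^[i] c)) = τ^[i] (τ (τ c)) := by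
    rw [← Function.iterate_succ_apply' τ, ← Function.iterate_succ_apply' τ,
      Function.iterate_succ_apply, Function.iterate_succ_apply]
  rw [h1]
  exact fun h' => h (τ.injective.iterate i h')

/-- Replacing a cycle of a permutation by a matching along the cycle, which misses only the point
`c` if the cycle is odd, and no point if it is even. -/
theorem exists_dissolve (τ : Equiv.Perm V) (c : V) :
    ∃ τ' : Equiv.Perm V, (∀ u ∉ orb τ c, τ' u = τ u) ∧
      (∀ u ∈ orb τ c, τ' u ∈ orb τ c ∧ τ' (τ' u) = u ∧ (τ' u = u ∨ τ' u = τ u ∨ τ (τ' u) = u) ∧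
        (τ' u = u → u = c ∧ Odd (Function.minimalPeriod τ c))) ∧
      (Odd (Function.minimalPeriod τ c) → τ' c = c) := by
  set L := Function.minimalPeriod τ c with hL
  have hinj : Set.InjOn (fun i => τ^[i] c) (Set.Iio L) :=
    Function.iterate_injOn_Iio_minimalPeriod
  have hLpos : 0 < L := minimalPeriod_pos τ c
  suffices H : ∃ f : V → V, (∀ u ∈ orb τ c, f u ∈ orb τ c ∧ f (f u) = u ∧
      (f u = u ∨ f u = τ u ∨ τ (f u) = u) ∧ (f u = u → u = c ∧ Odd L)) ∧
      (Odd L → f c = c) by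
    obtain ⟨f, hf, hc⟩ := H
    obtain ⟨τ', h1, h2⟩ := exists_glue τ f (orb τ c) (fun u hu => apply_mem_orb hu)
      (fun u hu => (hf u hu).1) (fun u hu v hv huv => by
        rw [← (hf u hu).2.1, huv, (hf v hv).2.1])
    refine ⟨τ', h2, fun u hu => ?_, fun hodd => by rw [h1 c (self_mem_orb τ c), hc hodd]⟩
    rw [h1 u hu, h1 _ (hf u hu).1]
    exact hf u hu
  rcases Nat.even_or_odd' L with ⟨n, hn | hn⟩
  · obtain ⟨f, hf1, hf2⟩ := exists_pairing (fun i => τ^[i] c) n (hn ▸ hinj)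
    refine ⟨f, fun u hu => ?_, fun hodd => absurd hodd (by rw [hn]; simp)⟩
    obtain ⟨i, hi, rfl⟩ := exists_lt_of_mem_orb hu
    rw [← hL] at hi
    rcases Nat.even_or_odd' i with ⟨j, rfl | rfl⟩
    · obtain ⟨h1, h2⟩ := hf1 j (by lia)
      rw [h1, h2]
      refine ⟨⟨_, rfl⟩, rfl, Or.inr (Or.inl (Function.iterate_succ_apply' _ _ _)), fun h => ?_⟩
      have := hinj (show 2 * j + 1 < L by lia) (show 2 * j < L by lia) h
      lia
    · obtain ⟨h1, h2⟩ := hf1 j (by lia)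
      rw [h2, h1]
      refine ⟨⟨_, rfl⟩, rfl, Or.inr (Or.inr (Function.iterate_succ_apply' _ _ _).symm),
        fun h => ?_⟩
      have := hinj (show 2 * j < L by lia) (show 2 * j + 1 < L by lia) h
      lia
  -- On an odd orbit the pairing starts at `τ c`, so `c` is the point left over.
  · obtain ⟨f, hf1, hf2⟩ := exists_pairing (fun i => τ^[i + 1] c) n (fun i hi j hj h => by
      have hi' : i < 2 * n := hi
      have hj' : j < 2 * n := hj
      have := hinj (show i + 1 < L by lia) (show j + 1 < L by lia) h
      lia)
    have hfc : f c = c := by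
      refine hf2 c fun i hi h => ?_
      have := hinj (show 0 < L from hLpos) (show i + 1 < L by lia) h
      lia
    refine ⟨f, fun u hu => ?_, fun _ => hfc⟩
    obtain ⟨i, hi, rfl⟩ := exists_lt_of_mem_orb hu
    rw [← hL] at hi
    rcases i with _ | i
    · rw [Function.iterate_zero_apply]
      exact ⟨by rw [hfc]; exact self_mem_orb τ c, by rw [hfc, hfc], Or.inl hfc,
        fun _ => ⟨rfl, n, hn⟩⟩
    rcases Nat.even_or_odd' i with ⟨j, rfl | rfl⟩
    · obtain ⟨h1, h2⟩ := hf1 j (by lia)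
      rw [h1, h2]
      refine ⟨⟨_, rfl⟩, rfl, Or.inr (Or.inl (Function.iterate_succ_apply' _ _ _)), fun h => ?_⟩
      have := hinj (show 2 * j + 1 + 1 < L by lia) (show 2 * j + 1 < L by lia) h
      lia
    · obtain ⟨h1, h2⟩ := hf1 j (by lia)
      rw [h2, h1]
      refine ⟨⟨_, rfl⟩, rfl, Or.inr (Or.inr (Function.iterate_succ_apply' _ _ _).symm),
        fun h => ?_⟩
      have := hinj (show 2 * j + 1 < L by lia) (show 2 * j + 1 + 1 < L by lia) h
      lia

omit [Fintype V] in
theorem movesAlong_of_dissolve {T : SimpleGraph V} {τ τ' : Equiv.Perm V} (hτ : MovesAlong T τ)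
    (h : ∀ u, τ' u = u ∨ τ' u = τ u ∨ τ (τ' u) = u) : MovesAlong T τ' := by
  intro u
  rcases h u with h1 | h1 | h1
  · exact Or.inl h1
  · rw [h1]; exact hτ u
  · rcases hτ (τ' u) with h2 | h2
    · left; rw [← h2, h1]
    · right; rw [h1] at h2; exact h2.symm

open Classical in
/-- A permutation that moves along edges can be turned into a matching along its cycles.  The
points missed by the matching may be prescribed to lie in any set that meets every odd cycle of
length at least three, apart from fixed points of the permutation. -/
theorem exists_involution_of_hit {T : SimpleGraph V} (B R : Set V) (σ : Equiv.Perm V)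
    (hσ : MovesAlong T σ) (hB : ∀ u ∈ B, σ u = u → u ∈ R)
    (hR : ∀ u n, σ (σ u) ≠ u → Odd n → σ^[n] u = u → ∃ r ∈ R, r ∈ orb σ u) :
    ∃ m : Equiv.Perm V, MovesAlong T m ∧ (∀ u, m (m u) = u) ∧ ∀ u ∈ B, m u = u → u ∈ R := by
  induction hk : (Finset.univ.filter fun u => σ (σ u) ≠ u).card using Nat.strong_induction_on
    generalizing σ with
  | _ k ih =>
  by_cases hinv : ∀ u, σ (σ u) = u
  · exact ⟨σ, hσ, hinv, hB⟩
  push Not at hinv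
  obtain ⟨u₀, hu₀⟩ := hinv
  -- An odd cycle is dissolved at a point of `R`, which may be missed; an even one can be dissolved
  -- anywhere.
  obtain ⟨c, hc, hcR⟩ : ∃ c ∈ orb σ u₀, Odd (Function.minimalPeriod σ c) → c ∈ R := by
    by_cases hodd : Odd (Function.minimalPeriod σ u₀)
    · obtain ⟨r, hr, hru⟩ := hR u₀ _ hu₀ hodd Function.iterate_minimalPeriod
      exact ⟨r, hru, fun _ => hr⟩
    · exact ⟨u₀, self_mem_orb _ _, fun h => absurd h hodd⟩
  obtain ⟨τ, h1, h2, h3⟩ := exists_dissolve σ c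
  have hoff : ∀ u ∉ orb σ c, σ u ∉ orb σ c := notMem_of_mapsTo fun u hu => apply_mem_orb hu
  have hττ : ∀ u, τ (τ u) ≠ u → u ∉ orb σ c ∧ σ (σ u) ≠ u := by
    intro u hu
    have hu' : u ∉ orb σ c := fun h => hu (h2 u h).2.1
    refine ⟨hu', ?_⟩
    rwa [h1 u hu', h1 _ (hoff u hu')] at hu
  refine ih _ ?_ τ (movesAlong_of_dissolve hσ fun u => ?_) ?_ ?_ rfl
  · rw [← hk]
    refine Finset.card_lt_card (Finset.ssubset_iff_of_subset ?_ |>.2 ⟨c, ?_, ?_⟩)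
    · intro u hu
      simp only [Finset.mem_filter, Finset.mem_univ, true_and] at hu ⊢
      exact (hττ u hu).2
    · simpa using apply_apply_ne_of_mem_orb hu₀ hc
    · simpa using (h2 c (self_mem_orb _ _)).2.1
  · by_cases hu : u ∈ orb σ c
    · exact (h2 u hu).2.2.1
    · exact Or.inr (Or.inl (h1 u hu))
  · intro u hu hfix
    by_cases huS : u ∈ orb σ c
    · obtain ⟨rfl, hodd⟩ := (h2 u huS).2.2.2 hfix
      exact hcR hodd
    · rw [h1 u huS] at hfix
      exact hB u hu hfix
  · intro u n hu hn hper
    obtain ⟨huS, hu'⟩ := hττ u hu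
    have hit := fun i => iterate_eq_of_eq_off hoff h1 huS i
    rw [(hit n).1] at hper
    obtain ⟨r, hr, i, hi⟩ := hR u n hu' hn hper
    exact ⟨r, hr, i, by rw [(hit i).1, hi]⟩

end PermSurgery

/-! ### Augmenting a matching to a covering permutation with few odd cycles. -/

section Augmentation

variable {V : Type*} [Fintype V]

/-- A permutation that moves along edges and whose cycles of length at least three are odd and
meet `R`; the fixed points that lie in `B` are in `R` as well. -/
structure IsOddCover (T : SimpleGraph V) (B : Set V) (k : ℕ) (τ : Equiv.Perm V) (R : Finset V) :
    Prop where
  moves : MovesAlong T τ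
  odd : ∀ u, τ (τ u) ≠ u → ∃ n, Odd n ∧ τ^[n] u = u
  hit : ∀ u, τ (τ u) ≠ u → ∃ r ∈ R, r ∈ orb τ u
  fixed : ∀ u ∈ B, τ u = u → u ∈ R
  card_le : R.card ≤ k

/-- Surgery inside an invariant set leaves the outside orbits intact, so only the points of `S` need
checking. -/
theorem IsOddCover.of_eq_off {T : SimpleGraph V} {B : Set V} {k : ℕ} {τ τ' : Equiv.Perm V}
    {R R' : Finset V} (h : IsOddCover T B k τ R) (S : Set V) (hS : ∀ u ∈ S, τ u ∈ S)
    (hoff : ∀ u ∉ S, τ' u = τ u) (hmoves : ∀ u ∈ S, τ' u = u ∨ T.Adj u (τ' u))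
    (hodd : ∀ u ∈ S, τ' (τ' u) ≠ u → ∃ n, Odd n ∧ τ'^[n] u = u)
    (hhit : ∀ u ∈ S, τ' (τ' u) ≠ u → ∃ r ∈ R', r ∈ orb τ' u)
    (hfixed : ∀ u ∈ S, u ∈ B → τ' u = u → u ∈ R') (hcard : R'.card ≤ k)
    (hRR : ∀ r ∈ R, r ∉ S → r ∈ R') : IsOddCover T B k τ' R' := by
  have hS' := notMem_of_mapsTo hS
  have hit : ∀ u ∉ S, ∀ n, _ := fun u hu n => iterate_eq_of_eq_off hS' hoff hu n
  have hne : ∀ u ∉ S, τ' (τ' u) ≠ u → τ (τ u) ≠ u := by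
    intro u hu h
    rwa [hoff u hu, hoff _ (hS' u hu)] at h
  refine ⟨fun u => ?_, fun u hu => ?_, fun u hu => ?_, fun u hu hf => ?_, hcard⟩
  · by_cases huS : u ∈ S
    · exact hmoves u huS
    · rw [hoff u huS]; exact h.moves u
  · by_cases huS : u ∈ S
    · exact hodd u huS hu
    · obtain ⟨n, hn, hn'⟩ := h.odd u (hne u huS hu)
      exact ⟨n, hn, by rw [(hit u huS n).1, hn']⟩
  · by_cases huS : u ∈ S
    · exact hhit u huS hu
    · obtain ⟨r, hr, i, hi⟩ := h.hit u (hne u huS hu)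
      exact ⟨r, hRR r hr (hi ▸ (hit u huS i).2), i, by rw [(hit u huS i).1, hi]⟩
  · by_cases huS : u ∈ S
    · exact hfixed u huS hu hf
    · rw [hoff u huS] at hf
      exact hRR u (h.fixed u hu hf) huS

open Classical in
/-- The number of uncovered points of `B`, and then the disagreement with `σ`, in lexicographic
order. -/
noncomputable def defect (B : Set V) (σ τ : Equiv.Perm V) : ℕ :=
  (Finset.univ.filter fun u => u ∈ B ∧ τ u = u).card * (Fintype.card V + 1) +
    (Finset.univ.filter fun u => τ u ≠ σ u).card

/-- Losing one uncovered point outweighs any change in disagreement, since the latter is at most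
`Fintype.card V`. -/
theorem defect_lt {B : Set V} {σ τ τ' : Equiv.Perm V} (h : ∀ u ∈ B, τ' u = u → τ u = u) {b : V}
    (hb : b ∈ B) (hτ : τ b = b) (hτ' : τ' b ≠ b) : defect B σ τ' < defect B σ τ := by
  classical
  unfold defect
  have h1 : (Finset.univ.filter fun u => u ∈ B ∧ τ' u = u).card <
      (Finset.univ.filter fun u => u ∈ B ∧ τ u = u).card := by
    refine Finset.card_lt_card ((Finset.ssubset_iff_of_subset ?_).2 ⟨b, ?_, ?_⟩)
    · intro u
      simp only [Finset.mem_filter, Finset.mem_univ, true_and]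
      exact fun hu => ⟨hu.1, h u hu.1 hu.2⟩
    · simp [hb, hτ]
    · simp [hτ']
  have h2 : (Finset.univ.filter fun u => τ' u ≠ σ u).card ≤ Fintype.card V :=
    Finset.card_le_univ _
  nlinarith

/-- One step of an alternating path. Minimality of the defect forces the `τ`-partner of `σ b` to be
`σ (σ b)`, and rematching `b` with `σ b` moves the uncovered point two steps along the `σ`-cycle
without increasing the defect. -/
theorem exists_exchange {T : SimpleGraph V} {B : Set V} {k : ℕ} {σ τ : Equiv.Perm V}
    {R : Finset V} (hσ : MovesAlong T σ) (hσB : ∀ u ∈ B, σ u ≠ u) (h : IsOddCover T B k τ R)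
    (hmin : ∀ τ' R', IsOddCover T B k τ' R' → defect B σ τ ≤ defect B σ τ') {b : V} (hb : b ∈ B)
    (hτb : τ b = b) :
    τ (τ (σ b)) = σ b ∧ τ (σ b) = σ (σ b) ∧ σ (σ b) ∈ B ∧ ∃ τ' R', IsOddCover T B k τ' R' ∧
      defect B σ τ' ≤ defect B σ τ ∧ τ' b = σ b ∧ τ' (σ b) = b ∧
      τ' (σ (σ b)) = σ (σ b) ∧ ∀ u, u ≠ b → u ≠ σ b → u ≠ σ (σ b) → τ' u = τ u := by
  classical
  set c := σ b with hc
  have hcb : c ≠ b := hσB b hb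
  have hadj : T.Adj b c := (hσ b).resolve_left hcb
  have hborb : b ∉ orb τ c := by
    intro hmem
    obtain ⟨i, hi⟩ := orb_symm hmem
    rw [Function.iterate_fixed hτb] at hi
    exact hcb hi.symm
  -- If the `τ`-cycle of `c` were odd (a fixed point included), dissolving it at `c` and matching
  -- `c` with `b` would cover `b` and uncover nothing.
  have hnodd : ¬ Odd (Function.minimalPeriod τ c) := by
    intro hodd
    obtain ⟨τ₁, h1, h2, h3⟩ := exists_dissolve τ c
    have h3 := h3 hodd
    have hτ₁b : τ₁ b = b := by rw [h1 b hborb, hτb]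
    have hb' : (τ₁ * Equiv.swap b c) b = c := by simp [h3]
    have hc' : (τ₁ * Equiv.swap b c) c = b := by simp [hτ₁b]
    have hu' : ∀ u, u ≠ b → u ≠ c → (τ₁ * Equiv.swap b c) u = τ₁ u := fun u h4 h5 => by
      simp [Equiv.swap_apply_of_ne_of_ne h4 h5]
    set τ' := τ₁ * Equiv.swap b c
    have hoff : ∀ u ∉ insert b (orb τ c), τ' u = τ u := by
      intro u hu
      rw [Set.mem_insert_iff, not_or] at hu
      rw [hu' u hu.1 (fun h => hu.2 (h ▸ self_mem_orb τ c)), h1 u hu.2]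
    have hon : ∀ u ∈ insert b (orb τ c), τ' u ≠ u ∧ τ' (τ' u) = u ∧
        (τ' u = u ∨ T.Adj u (τ' u)) := by
      intro u hu
      by_cases hub : u = b
      · subst hub; rw [hb', hc']; exact ⟨hcb, rfl, Or.inr hadj⟩
      by_cases huc : u = c
      · subst huc; rw [hc', hb']; exact ⟨hcb.symm, rfl, Or.inr hadj.symm⟩
      have huo : u ∈ orb τ c := hu.resolve_left hub
      obtain ⟨h4, h5, h6, h7⟩ := h2 u huo
      rw [hu' u hub huc, hu' (τ₁ u) (fun h => hborb (h ▸ h4))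
        (fun h => huc (τ₁.injective (h.trans h3.symm)))]
      refine ⟨fun h => huc (h7 h).1, h5, ?_⟩
      rcases h6 with h6 | h6 | h6
      · exact Or.inl h6
      · rw [h6]; exact h.moves u
      · rcases h.moves (τ₁ u) with h8 | h8
        · left; rw [← h8, h6]
        · right; rw [h6] at h8; exact h8.symm
    have hS : ∀ u ∈ insert b (orb τ c), τ u ∈ insert b (orb τ c) := by
      rintro u (rfl | hu)
      · rw [hτb]; exact Set.mem_insert _ _
      · exact Or.inr (apply_mem_orb hu)
    have hst : IsOddCover T B k τ' R := h.of_eq_off (insert b (orb τ c)) hS hoff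
      (fun u hu => (hon u hu).2.2) (fun u hu h' => absurd (hon u hu).2.1 h')
      (fun u hu h' => absurd (hon u hu).2.1 h') (fun u hu _ h' => absurd h' (hon u hu).1)
      h.card_le (fun r hr _ => hr)
    refine absurd (hmin τ' R hst) (not_le.2 (defect_lt (fun u _ hfix => ?_) hb hτb ?_))
    · have : u ∉ insert b (orb τ c) := fun hu => (hon u hu).1 hfix
      rwa [hoff u this] at hfix
    · rw [hb']; exact hcb
  -- All cycles of length at least three are odd, so `c` lies in a 2-cycle.
  have hcc : τ (τ c) = c := by
    by_contra hcon
    obtain ⟨n, hn, hn'⟩ := h.odd c hcon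
    exact hnodd (odd_minimalPeriod hn hn')
  have hdc : τ c ≠ c := fun h' => hnodd (by
    rw [Function.minimalPeriod_eq_one_iff_isFixedPt.2 h']; exact odd_one)
  set d := τ c with hd
  have hdb : d ≠ b := fun h' => hcb (by rw [← hcc, h', hτb])
  -- Conjugating by the swap exchanges the roles of `b` and `d`: now `b` is matched with `c` and `d`
  -- is fixed.
  have hb' : (Equiv.swap b d * τ * Equiv.swap b d) b = c := by
    simp [hcc, Equiv.swap_apply_of_ne_of_ne hcb hdc.symm]
  have hc' : (Equiv.swap b d * τ * Equiv.swap b d) c = b := by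
    simp [Equiv.swap_apply_of_ne_of_ne hcb hdc.symm, ← hd]
  have hd' : (Equiv.swap b d * τ * Equiv.swap b d) d = d := by simp [hτb]
  have hu' : ∀ u, u ≠ b → u ≠ c → u ≠ d →
      (Equiv.swap b d * τ * Equiv.swap b d) u = τ u := fun u h4 h5 h6 => by
    simp only [Equiv.Perm.mul_apply, Equiv.swap_apply_of_ne_of_ne h4 h6]
    exact Equiv.swap_apply_of_ne_of_ne (fun h' => h4 (τ.injective (h'.trans hτb.symm)))
      (fun h' => h5 (τ.injective h'))
  set τ' := Equiv.swap b d * τ * Equiv.swap b d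
  have hS : ∀ u ∈ ({b, c, d} : Set V), τ u ∈ ({b, c, d} : Set V) := by
    rintro u (rfl | rfl | rfl)
    · simp [hτb]
    · simp [← hd]
    · simp [hcc]
  have hoff : ∀ u ∉ ({b, c, d} : Set V), τ' u = τ u := by
    intro u hu
    simp only [Set.mem_insert_iff, Set.mem_singleton_iff, not_or] at hu
    exact hu' u hu.1 hu.2.1 hu.2.2
  have hon : ∀ u ∈ ({b, c, d} : Set V), τ' (τ' u) = u ∧ (τ' u = u ∨ T.Adj u (τ' u)) ∧
      (τ' u = u → u = d) := by
    rintro u (rfl | rfl | rfl)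
    · rw [hb', hc']; exact ⟨rfl, Or.inr hadj, fun h' => absurd h' hcb⟩
    · rw [hc', hb']; exact ⟨rfl, Or.inr hadj.symm, fun h' => absurd h'.symm hcb⟩
    · rw [hd', hd']; exact ⟨rfl, Or.inl rfl, fun _ => rfl⟩
  have hst : ∀ R', R'.card ≤ k → (∀ r ∈ R, r ≠ b → r ∈ R') → (d ∈ B → d ∈ R') →
      IsOddCover T B k τ' R' := fun R' hR1 hR2 hR3 =>
    h.of_eq_off {b, c, d} hS hoff (fun u hu => (hon u hu).2.1)
      (fun u hu h' => absurd (hon u hu).1 h') (fun u hu h' => absurd (hon u hu).1 h')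
      (fun u hu huB hfix => by
        have := (hon u hu).2.2 hfix
        subst this
        exact hR3 huB) hR1
      (fun r hr hrS => hR2 r hr fun h' => hrS (by simp [h']))
  have hdB : d ∈ B := by
    by_contra hdB
    refine absurd (hmin τ' R (hst R h.card_le (fun r hr _ => hr) fun h' => absurd h' hdB))
      (not_le.2 (defect_lt (fun u huB hfix => ?_) hb hτb (by rw [hb']; exact hcb)))
    by_cases hu : u ∈ ({b, c, d} : Set V)
    · exact absurd ((hon u hu).2.2 hfix ▸ huB) hdB
    · rwa [hoff u hu] at hfix
  -- The new fixed point takes the place of `b` in `R`, which keeps the size bound.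
  have hst' := hst (insert d (R.erase b))
    (by
      refine (Finset.card_insert_le _ _).trans ?_
      have := Finset.card_erase_add_one (h.fixed b hb hτb)
      have := h.card_le
      lia)
    (fun r hr hrb => Finset.mem_insert_of_mem (Finset.mem_erase.2 ⟨hrb, hr⟩))
    (fun _ => Finset.mem_insert_self _ _)
  have hfixcard : (Finset.univ.filter fun u => u ∈ B ∧ τ' u = u).card ≤
      (Finset.univ.filter fun u => u ∈ B ∧ τ u = u).card := by
    have hbm : b ∈ Finset.univ.filter fun u => u ∈ B ∧ τ u = u := by simp [hb, hτb]
    have hsub : (Finset.univ.filter fun u => u ∈ B ∧ τ' u = u) ⊆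
        insert d ((Finset.univ.filter fun u => u ∈ B ∧ τ u = u).erase b) := by
      intro u hu
      simp only [Finset.mem_filter, Finset.mem_univ, true_and, Finset.mem_insert,
        Finset.mem_erase] at hu ⊢
      by_cases huS : u ∈ ({b, c, d} : Set V)
      · exact Or.inl ((hon u huS).2.2 hu.2)
      · refine Or.inr ⟨fun h' => huS (by simp [h']), hu.1, ?_⟩
        rw [← hoff u huS]; exact hu.2
    have h4 := Finset.card_le_card hsub
    have h5 := Finset.card_insert_le d ((Finset.univ.filter fun u => u ∈ B ∧ τ u = u).erase b)
    have h6 := Finset.card_erase_add_one hbm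
    lia
  have hbD : b ∈ Finset.univ.filter fun u => τ u ≠ σ u := by
    simp only [Finset.mem_filter, Finset.mem_univ, true_and, hτb]
    exact hcb.symm
  have hD := Finset.card_erase_add_one hbD
  have hdD : τ d ≠ σ d := by
    rw [hcc, hc]
    exact fun h' => hdb (σ.injective h').symm
  -- Otherwise agreement with `σ` is gained at `b` and lost nowhere: at `c` and `d` the old `τ`
  -- already disagreed.
  have hsc : d = σ c := by
    by_contra hsc
    have hsub : (Finset.univ.filter fun u => τ' u ≠ σ u) ⊆
        (Finset.univ.filter fun u => τ u ≠ σ u).erase b := by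
      intro u hu
      simp only [Finset.mem_filter, Finset.mem_univ, true_and, Finset.mem_erase] at hu ⊢
      have hub : u ≠ b := fun h' => hu (by rw [h', hb'])
      refine ⟨hub, ?_⟩
      by_cases huc : u = c
      · rw [huc, ← hd]; exact hsc
      by_cases hud : u = d
      · rw [hud]; exact hdD
      rwa [hu' u hub huc hud] at hu
    have h4 := Finset.card_le_card hsub
    have h5 := hmin _ _ hst'
    unfold defect at h5
    nlinarith
  refine ⟨hcc, hsc, hsc ▸ hdB, τ', _, hst', ?_, hb', hc', hsc ▸ hd', fun u h4 h5 h6 =>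
    hu' u h4 h5 (hsc ▸ h6)⟩
  have hsub : (Finset.univ.filter fun u => τ' u ≠ σ u) ⊆
      insert c ((Finset.univ.filter fun u => τ u ≠ σ u).erase b) := by
    intro u hu
    simp only [Finset.mem_filter, Finset.mem_univ, true_and, Finset.mem_insert,
      Finset.mem_erase] at hu ⊢
    have hub : u ≠ b := fun h' => hu (by rw [h', hb'])
    by_cases huc : u = c
    · exact Or.inl huc
    refine Or.inr ⟨hub, ?_⟩
    by_cases hud : u = d
    · rw [hud]; exact hdD
    rwa [hu' u hub huc hud] at hu
  have h4 := Finset.card_le_card hsub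
  have h5 := Finset.card_insert_le c ((Finset.univ.filter fun u => τ u ≠ σ u).erase b)
  unfold defect
  have := Nat.mul_le_mul_right (Fintype.card V + 1) hfixcard
  lia

/-- If some permutation that moves along edges covers `B`, then a matching that misses at most `k`
points of `B` can be turned into a permutation that covers `B`, whose cycles of length at least
three are odd and are met by a set of at most `k` points. -/
theorem exists_isOddCover_of_involution {T : SimpleGraph V} {B : Set V} {σ m : Equiv.Perm V}
    (hσ : MovesAlong T σ) (hσB : ∀ u ∈ B, σ u ≠ u) (hm : MovesAlong T m)
    (hmm : ∀ u, m (m u) = u) (R₀ : Finset V) (hR₀ : ∀ u ∈ B, m u = u → u ∈ R₀) :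
    ∃ τ R, IsOddCover T B R₀.card τ R ∧ ∀ u ∈ B, τ u ≠ u := by
  classical
  set k := R₀.card
  have h₀ : IsOddCover T B k m R₀ :=
    ⟨hm, fun u hu => absurd (hmm u) hu, fun u hu => absurd (hmm u) hu, hR₀, le_rfl⟩
  have hex : ∃ n, ∃ τ R, IsOddCover T B k τ R ∧ defect B σ τ = n := ⟨_, m, R₀, h₀, rfl⟩
  obtain ⟨τ₀, R₁, hτ₀, hdef⟩ := Nat.find_spec hex
  have hmin : ∀ τ, defect B σ τ ≤ defect B σ τ₀ → ∀ τ' R', IsOddCover T B k τ' R' →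
      defect B σ τ ≤ defect B σ τ' := fun τ hτ τ' R' h' =>
    hτ.trans (hdef ▸ Nat.find_min' hex ⟨τ', R', h', rfl⟩)
  refine ⟨τ₀, R₁, hτ₀, fun b hb hfix => ?_⟩
  set L := Function.minimalPeriod σ b with hL
  have hLpos : 0 < L := minimalPeriod_pos σ b
  have hinj : ∀ i j, i < L → j < L → σ^[i] b = σ^[j] b → i = j := fun i j hi hj h =>
    Function.iterate_injOn_Iio_minimalPeriod hi hj h
  -- The uncovered point travels along the `σ`-cycle of `b` two steps at a time and leaves matched
  -- pairs behind.
  have claim : ∀ n, 2 * n < L → ∃ τ R, IsOddCover T B k τ R ∧ defect B σ τ ≤ defect B σ τ₀ ∧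
      σ^[2 * n] b ∈ B ∧ τ (σ^[2 * n] b) = σ^[2 * n] b ∧
      ∀ j < n, τ (σ^[2 * j] b) = σ^[2 * j + 1] b ∧ τ (σ^[2 * j + 1] b) = σ^[2 * j] b := by
    intro n
    induction n with
    | zero => exact fun _ => ⟨τ₀, R₁, hτ₀, le_rfl, hb, hfix, by simp⟩
    | succ n ih =>
      intro hn
      obtain ⟨τ, R, hτ, hle, hB, hf, hpair⟩ := ih (by lia)
      obtain ⟨-, -, h3, τ', R', hτ', hle', h4, h5, h6, h7⟩ :=
        exists_exchange hσ hσB hτ (hmin τ hle) hB hf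
      simp only [← Function.iterate_succ_apply' σ] at h3 h4 h5 h6 h7
      refine ⟨τ', R', hτ', hle'.trans hle, h3, h6, fun j hj => ?_⟩
      rcases Nat.lt_succ_iff_lt_or_eq.1 hj with hj' | rfl
      · have hne : ∀ i < 2 * n, τ' (σ^[i] b) = τ (σ^[i] b) := fun i hi =>
          h7 _ (fun h => by have := hinj _ _ (by lia) (by lia) h; lia)
            (fun h => by have := hinj _ _ (by lia) (by lia) h; lia)
            (fun h => by have := hinj _ _ (by lia) (by lia) h; lia)
        rw [hne _ (by lia), hne _ (by lia)]
        exact hpair j hj'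
      · exact ⟨h4, h5⟩
  rcases Nat.even_or_odd' L with ⟨n, hn | hn⟩
  -- On an even cycle a last exchange would need `b` as the partner of its predecessor, but `b` is
  -- matched with `σ b`, or still uncovered when `L = 2`.
  · obtain ⟨n, rfl⟩ : ∃ n', n = n' + 1 := ⟨n - 1, by lia⟩
    obtain ⟨τ, R, hτ, hle, hB, hf, hpair⟩ := claim n (by lia)
    obtain ⟨h1, h2, -⟩ := exists_exchange hσ hσB hτ (hmin τ hle) hB hf
    simp only [← Function.iterate_succ_apply' σ] at h1 h2
    have hper : σ^[2 * n + 1 + 1] b = b := by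
      have : 2 * n + 1 + 1 = L := by lia
      rw [this, hL, Function.iterate_minimalPeriod]
    rw [Nat.succ_eq_add_one] at h1 h2
    rw [hper] at h2
    rw [h2] at h1
    rcases Nat.eq_zero_or_pos n with rfl | hnpos
    · have h8 : τ b = b := hf
      rw [h8] at h1
      have := hinj 0 (2 * 0 + 1) (by lia) (by lia) h1
      lia
    · have h8 := (hpair 0 hnpos).1
      have h9 : σ^[1] b = σ^[2 * n + 1] b := h8.symm.trans h1
      have := hinj 1 (2 * n + 1) (by lia) (by lia) h9
      lia
  · obtain ⟨τ, R, hτ, hle, hB, hf, hpair⟩ := claim n (by lia)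
    have hS : ∀ u ∈ orb σ b, τ u ∈ orb σ b := by
      intro u hu
      obtain ⟨i, hi, rfl⟩ := exists_lt_of_mem_orb hu
      rcases Nat.even_or_odd' i with ⟨j, rfl | rfl⟩
      · rcases (show j < n ∨ j = n by lia) with hj | rfl
        · rw [(hpair j hj).1]; exact ⟨_, rfl⟩
        · rw [hf]; exact ⟨_, rfl⟩
      · rw [(hpair j (by lia)).2]; exact ⟨_, rfl⟩
    -- On an odd cycle all points but one are now paired within the orbit, so `σ` can replace `τ`
    -- there. The former uncovered point, already in `R`, meets the new odd cycle, and the defect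
    -- drops.
    obtain ⟨τ', h1, h2⟩ := exists_glue τ σ (orb σ b) hS (fun u hu => apply_mem_orb hu)
      σ.injective.injOn
    have hiter : ∀ i, ∀ u ∈ orb σ b, τ'^[i] u = σ^[i] u ∧ σ^[i] u ∈ orb σ b := by
      intro i u hu
      induction i with
      | zero => exact ⟨rfl, hu⟩
      | succ i ih =>
        rw [Function.iterate_succ_apply', Function.iterate_succ_apply', ih.1, h1 _ ih.2]
        exact ⟨rfl, apply_mem_orb ih.2⟩
    have hst : IsOddCover T B k τ' R := by
      refine hτ.of_eq_off (orb σ b) hS h2 (fun u hu => by rw [h1 u hu]; exact hσ u)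
        (fun u hu _ => ⟨L, ⟨n, hn⟩, ?_⟩)
        (fun u hu _ => ⟨σ^[2 * n] b, hτ.fixed _ hB hf, ?_⟩)
        (fun u hu huB hfix => absurd (h1 u hu ▸ hfix) (hσB u huB)) hτ.card_le (fun r hr _ => hr)
      · rw [(hiter L u hu).1]
        exact iterate_eq_self_of_mem_orb Function.iterate_minimalPeriod hu
      · obtain ⟨i, hi⟩ := orb_trans (orb_symm hu) (show σ^[2 * n] b ∈ orb σ b from ⟨_, rfl⟩)
        exact ⟨i, by rw [(hiter i u hu).1, hi]⟩
    refine absurd (hmin τ hle τ' R hst) (not_le.2 (defect_lt (fun u huB hfix => ?_) hB hf ?_))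
    · have hu : u ∉ orb σ b := fun hu => hσB u huB (by rw [← h1 u hu]; exact hfix)
      rwa [h2 u hu] at hfix
    · rw [h1 _ ⟨_, rfl⟩]
      exact hσB _ hB

end Augmentation

/-! ### Optimal duals, tight edges and complementary slackness. -/

section Complementarity

variable {V : Type*} [Fintype V]

/-- An optimal solution of the dual of the fractional matching problem. -/
structure IsOptDual (G : SimpleGraph V) (w : Sym2 V → ℝ) (y : V → ℝ) : Prop where
  nonneg : ∀ v, 0 ≤ y v
  cover : ∀ u v, G.Adj u v → w s(u, v) ≤ y u + y v
  attained : ∃ x ∈ fracMatchings G, ∑ v, y v ≤ fracWeight G w x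

/-- The edges at which a dual solution is tight. -/
def tightGraph (G : SimpleGraph V) (w : Sym2 V → ℝ) (y : V → ℝ) : SimpleGraph V where
  Adj u v := G.Adj u v ∧ w s(u, v) = y u + y v
  symm := ⟨fun u v h => ⟨h.1.symm, by rw [Sym2.eq_swap, h.2, add_comm]⟩⟩
  loopless := ⟨fun _ h => h.1.ne rfl⟩

omit [Fintype V] in
theorem MovesAlong.mono {G H : SimpleGraph V} {σ : Equiv.Perm V} (hσ : MovesAlong G σ)
    (h : ∀ u v, G.Adj u v → H.Adj u v) : MovesAlong H σ :=
  fun u => (hσ u).imp_right (h _ _)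

omit [Fintype V] in
theorem MovesAlong.of_tightGraph {G : SimpleGraph V} {w : Sym2 V → ℝ} {y : V → ℝ}
    {σ : Equiv.Perm V} (hσ : MovesAlong (tightGraph G w y) σ) : MovesAlong G σ :=
  hσ.mono fun _ _ h => h.1

theorem exists_dual_cover (G : SimpleGraph V) (w : Sym2 V → ℝ) (θ : ℝ)
    (h : ∀ x ∈ fracMatchings G, fracWeight G w x ≤ θ) :
    ∃ y : V → ℝ, (∀ v, 0 ≤ y v) ∧ ∑ v, y v ≤ θ ∧ ∀ u v, G.Adj u v → w s(u, v) ≤ y u + y v := by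
  classical
  obtain ⟨y, h0, h1, h2⟩ := exists_dual_of_forall_le
    (fun (e : Sym2 V) (v : V) => if e ∈ G.incidenceFinset v then (1 : ℝ) else 0)
    (fun e => if e ∈ G.edgeFinset then w e else 0) θ (fun x hx0 hx1 => by
      have e1 : ∀ v, ∑ e, x e * (if e ∈ G.incidenceFinset v then (1 : ℝ) else 0) =
          ∑ e ∈ G.incidenceFinset v, x e := fun v => by
        simp only [mul_ite, mul_one, mul_zero]
        rw [← Finset.sum_filter]
        congr 1; ext e; simp
      simp only [e1] at hx1
      have := h (fun e => if e ∈ G.edgeFinset then x e else 0)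
        ⟨fun e he => by simp [he], fun e he => by simp [he, hx0 e], fun v => ?_⟩
      · refine le_trans (le_of_eq ?_) this
        unfold fracWeight
        simp only [ite_mul, zero_mul]
        rw [← Finset.sum_filter, Finset.filter_mem_eq_inter, Finset.univ_inter]
        exact Finset.sum_congr rfl fun e he => by rw [if_pos he]
      · refine le_trans (le_of_eq (Finset.sum_congr rfl fun e he => ?_)) (hx1 v)
        exact if_pos (G.incidenceFinset_subset v he))
  refine ⟨y, h0, h1, fun u v huv => ?_⟩
  have := h2 s(u, v)
  rw [if_pos (by simpa using huv)] at this
  refine this.trans (le_of_eq ?_)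
  simp only [ite_mul, one_mul, zero_mul]
  rw [← Finset.sum_filter]
  have e2 : (Finset.univ.filter fun j => s(u, v) ∈ G.incidenceFinset j) = {u, v} := by
    ext j
    simp only [Finset.mem_filter, Finset.mem_univ, true_and, SimpleGraph.mem_incidenceFinset,
      SimpleGraph.mk'_mem_incidenceSet_iff, huv, Finset.mem_insert, Finset.mem_singleton]
  rw [e2, Finset.sum_pair huv.ne]

theorem cover_term_nonneg {G : SimpleGraph V} {w : Sym2 V → ℝ} {y : V → ℝ}
    (hy : ∀ u v, G.Adj u v → w s(u, v) ≤ y u + y v) {x : Sym2 V → ℝ} (hx : x ∈ fracMatchings G)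
    (u v : V) : 0 ≤ (y u + y v - w s(u, v)) * x s(u, v) := by
  rw [mem_fracMatchings_iff] at hx
  by_cases h : G.Adj u v
  · exact mul_nonneg (by linarith [hy u v h]) (hx.2.1 _)
  · rw [hx.1 _ (by simpa using h), mul_zero]

theorem fracWeight_le_sum {G : SimpleGraph V} {w : Sym2 V → ℝ} {y : V → ℝ} (h0 : ∀ v, 0 ≤ y v)
    (hy : ∀ u v, G.Adj u v → w s(u, v) ≤ y u + y v) {x : Sym2 V → ℝ} (hx : x ∈ fracMatchings G) :
    fracWeight G w x ≤ ∑ v, y v := by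
  have hx' := (mem_fracMatchings_iff G x).1 hx
  have h1 := sum_sub_fracWeight G w hx'.1 y
  have h2 : 0 ≤ ∑ u, ∑ v, (y u + y v - w s(u, v)) * x s(u, v) :=
    Finset.sum_nonneg fun u _ => Finset.sum_nonneg fun v _ => cover_term_nonneg hy hx u v
  have h3 : 0 ≤ ∑ u, y u * (1 - ∑ v, x s(u, v)) :=
    Finset.sum_nonneg fun u _ => mul_nonneg (h0 u) (by linarith [hx'.2.2 u])
  linarith

/-- The duality gap is a sum of nonnegative complementarity terms; when it closes, every term
vanishes. -/
theorem IsOptDual.tight_of_forall_le {G : SimpleGraph V} {w : Sym2 V → ℝ} {y : V → ℝ}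
    (hy : IsOptDual G w y) {σ : Equiv.Perm V} (hσ : MovesAlong G σ)
    (hmax : ∑ v, y v ≤ fracWeight G w (permVec σ)) :
    MovesAlong (tightGraph G w y) σ ∧ ∀ u ∈ {u | 0 < y u}, σ u ≠ u := by
  classical
  have hx := permVec_mem_fracMatchings hσ
  have hx' := (mem_fracMatchings_iff G _).1 hx
  have h1 := sum_sub_fracWeight G w hx'.1 y
  have hn2 : ∀ u, 0 ≤ ∑ v, (y u + y v - w s(u, v)) * permVec σ s(u, v) := fun u =>
    Finset.sum_nonneg fun v _ => cover_term_nonneg hy.cover hx u v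
  have hn3 : ∀ u, 0 ≤ y u * (1 - ∑ v, permVec σ s(u, v)) := fun u =>
    mul_nonneg (hy.nonneg u) (by linarith [hx'.2.2 u])
  have h2 := Finset.sum_nonneg fun u (_ : u ∈ Finset.univ) => hn2 u
  have h3 := Finset.sum_nonneg fun u (_ : u ∈ Finset.univ) => hn3 u
  have h4 : ∑ u, ∑ v, (y u + y v - w s(u, v)) * permVec σ s(u, v) = 0 := by linarith
  have h5 : ∑ u, y u * (1 - ∑ v, permVec σ s(u, v)) = 0 := by linarith
  rw [Finset.sum_eq_zero_iff_of_nonneg fun u _ => hn2 u] at h4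
  rw [Finset.sum_eq_zero_iff_of_nonneg fun u _ => hn3 u] at h5
  refine ⟨fun u => ?_, fun u hu hfix => ?_⟩
  · by_cases h : σ u = u
    · exact Or.inl h
    have h6 := h4 u (Finset.mem_univ _)
    rw [Finset.sum_eq_zero_iff_of_nonneg fun v _ => cover_term_nonneg hy.cover hx u v] at h6
    have h7 := h6 (σ u) (Finset.mem_univ _)
    have h8 : permVec σ s(u, σ u) ≠ 0 := by
      rw [permVec_mk, if_neg (Ne.symm h), if_pos rfl]
      split_ifs <;> norm_num
    refine Or.inr ⟨(hσ u).resolve_left h, ?_⟩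
    have := (mul_eq_zero.1 h7).resolve_right h8
    linarith
  · have h6 := h5 u (Finset.mem_univ _)
    rw [sum_permVec, if_pos hfix] at h6
    have : 0 < y u := hu
    linarith

theorem fracWeight_permVec {G : SimpleGraph V} {w : Sym2 V → ℝ} {y : V → ℝ}
    (h0 : ∀ v, 0 ≤ y v) {σ : Equiv.Perm V} (hσ : MovesAlong (tightGraph G w y) σ)
    (hB : ∀ u ∈ {u | 0 < y u}, σ u ≠ u) : fracWeight G w (permVec σ) = ∑ v, y v := by
  classical
  have hx := (mem_fracMatchings_iff _ _).1 (permVec_mem_fracMatchings hσ)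
  have hx' := (mem_fracMatchings_iff _ _).1 (permVec_mem_fracMatchings hσ.of_tightGraph)
  have h1 := sum_sub_fracWeight G w hx'.1 y
  have h2 : ∑ u, ∑ v, (y u + y v - w s(u, v)) * permVec σ s(u, v) = 0 := by
    refine Finset.sum_eq_zero fun u _ => Finset.sum_eq_zero fun v _ => ?_
    by_cases h : (tightGraph G w y).Adj u v
    · rw [h.2]; ring
    · rw [hx.1 _ (by simpa using h), mul_zero]
  have h3 : ∑ u, y u * (1 - ∑ v, permVec σ s(u, v)) = 0 := by
    refine Finset.sum_eq_zero fun u _ => ?_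
    rw [sum_permVec]
    rcases (h0 u).eq_or_lt with h | h
    · rw [← h, zero_mul]
    · rw [if_neg (hB u h)]; ring
  linarith

theorem exists_isOptDual (G : SimpleGraph V) (w : Sym2 V → ℝ) : ∃ y, IsOptDual G w y := by
  obtain ⟨x, hx, hmax⟩ := basicMaxFracMatchings_nonempty G w
  obtain ⟨y, h0, h1, h2⟩ := exists_dual_cover G w _ hmax
  exact ⟨y, h0, h2, x, hx.1, h1⟩

theorem mem_fracMatchings_of_le {G H : SimpleGraph V} (h : G ≤ H) {x : Sym2 V → ℝ}
    (hx : x ∈ fracMatchings G) : x ∈ fracMatchings H := by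
  rw [mem_fracMatchings_iff] at hx ⊢
  exact ⟨fun e he => hx.1 e fun h' => he (SimpleGraph.edgeSet_mono h h'), hx.2⟩

open Classical in
/-- A graph and the graph without the edges at a vertex have a common optimal dual solution, up to
the value at that vertex. -/
theorem exists_common_isOptDual (G : SimpleGraph V) (w : Sym2 V → ℝ) (v : V) :
    ∃ y, IsOptDual G w y ∧ IsOptDual (G.deleteIncidenceSet v) w (Function.update y v 0) := by
  obtain ⟨x₁, hx₁, hmax₁⟩ := basicMaxFracMatchings_nonempty G w
  obtain ⟨x₂, hx₂, hmax₂⟩ := basicMaxFracMatchings_nonempty (G.deleteIncidenceSet v) w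
  have hle := G.deleteIncidenceSet_le v
  -- The price of `v`: the amount by which its edges raise the optimum. Charging `g` on every edge
  -- at `v` brings the optimum down to that of the graph without them, since a permutation either
  -- covers `v` and pays `g` or avoids `v`. Adding `g` back at `v` to a dual for the charged weights
  -- gives the common dual.
  set g := fracWeight G w x₁ - fracWeight (G.deleteIncidenceSet v) w x₂ with hg
  have hg0 : 0 ≤ g := by
    have := hmax₁ x₂ (mem_fracMatchings_of_le hle hx₂.1)
    rw [fracWeight_eq_of_le w hle ((mem_fracMatchings_iff _ _).1 hx₂.1).1] at this
    linarith
  let w' : Sym2 V → ℝ := fun e => w e - if v ∈ e then g else 0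
  have hw' : ∀ x ∈ fracMatchings G,
      fracWeight G w' x = fracWeight G w x - g * ∑ u, x s(v, u) := by
    intro x hx
    rw [← sum_incidenceFinset G hx.1, SimpleGraph.incidenceFinset_eq_filter, Finset.sum_filter,
      Finset.mul_sum, fracWeight, fracWeight, ← Finset.sum_sub_distrib]
    refine Finset.sum_congr rfl fun e _ => ?_
    simp only [w']
    split_ifs <;> ring
  have hperm : ∀ σ, MovesAlong G σ → fracWeight G w' (permVec σ) ≤ fracWeight G w x₁ - g := by
    intro σ hσ
    rw [hw' _ (permVec_mem_fracMatchings hσ), sum_permVec]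
    split_ifs with h
    · have hσ' : MovesAlong (G.deleteIncidenceSet v) σ := by
        intro u
        by_cases hu : σ u = u
        · exact Or.inl hu
        · refine Or.inr (SimpleGraph.deleteIncidenceSet_adj.2
            ⟨(hσ u).resolve_left hu, fun h' => hu (h' ▸ h), fun h' => hu (σ.injective ?_)⟩)
          rw [h', h]
      have h1 := permVec_mem_fracMatchings hσ'
      have h2 := hmax₂ _ h1
      rw [fracWeight_eq_of_le w hle ((mem_fracMatchings_iff _ _).1 h1).1]
      linarith
    · have := hmax₁ _ (permVec_mem_fracMatchings hσ)
      linarith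
  have hall : ∀ x ∈ fracMatchings G, fracWeight G w' x ≤ fracWeight G w x₁ - g := by
    have hconv : Convex ℝ {x : Sym2 V → ℝ | fracWeight G w' x ≤ fracWeight G w x₁ - g} := by
      refine convex_halfSpace_le (IsLinearMap.mk (fun a b => ?_) fun c a => ?_) _
      · simp [fracWeight, mul_add, Finset.sum_add_distrib]
      · simp only [fracWeight, Pi.smul_apply, smul_eq_mul, Finset.mul_sum]
        exact Finset.sum_congr rfl fun e _ => by ring
    intro x hx
    refine convexHull_min ?_ hconv (fracMatchings_subset_convexHull G hx)
    rintro _ ⟨σ, hσ, rfl⟩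
    exact hperm σ hσ
  obtain ⟨y, h0, h1, h2⟩ := exists_dual_cover G w' _ hall
  have hsum : ∑ u, (y u + if u = v then g else 0) = ∑ u, y u + g := by
    simp [Finset.sum_add_distrib]
  have hcov : ∀ a b, G.Adj a b →
      w s(a, b) ≤ (y a + if a = v then g else 0) + (y b + if b = v then g else 0) := by
    intro a b hab
    have h3 := h2 a b hab
    simp only [w', Sym2.mem_iff] at h3
    have := hab.ne
    by_cases hav : a = v
    · subst hav; simp [this.symm] at h3 ⊢; linarith
    · by_cases hbv : b = v
      · subst hbv; simp [hav] at h3 ⊢; linarith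
      · simp [hav, hbv, Ne.symm hav, Ne.symm hbv] at h3 ⊢; linarith
  refine ⟨fun u => y u + if u = v then g else 0, ⟨fun u => ?_, hcov, x₁, hx₁.1, ?_⟩,
    ⟨fun u => ?_, fun a b hab => ?_, x₂, hx₂.1, ?_⟩⟩
  · have := h0 u
    split_ifs <;> linarith
  · rw [hsum]; linarith
  · have := h0 u
    by_cases hu : u = v
    · subst hu; simp
    · simp [hu, this]
  · rw [SimpleGraph.deleteIncidenceSet_adj] at hab
    rw [Function.update_of_ne hab.2.1, Function.update_of_ne hab.2.2]
    exact hcov a b hab.1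
  · have h3 := Finset.add_sum_erase Finset.univ (fun u => y u + if u = v then g else 0)
      (Finset.mem_univ v)
    rw [hsum] at h3
    rw [← Finset.add_sum_erase Finset.univ _ (Finset.mem_univ v), Function.update_self, zero_add,
      Finset.sum_congr rfl fun u hu => Function.update_of_ne (Finset.ne_of_mem_erase hu) _ _]
    simp only [if_true] at h3
    linarith [h0 v]

end Complementarity

/-! ### The odd cycles in `𝒞(x)` as odd orbits, and extremality. -/

section OddCycles

variable {V : Type*}

theorem permVec_ne_zero {τ : Equiv.Perm V} {a b : V} (h : permVec τ s(a, b) ≠ 0) :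
    a ≠ b ∧ (τ a = b ∨ τ b = a) := by
  rw [permVec_mk] at h
  split_ifs at h <;> simp_all

theorem permVec_of_apply_apply_ne {τ : Equiv.Perm V} {u : V} (h : τ (τ u) ≠ u) :
    permVec τ s(u, τ u) = 1 / 2 := by
  rw [permVec_mk, if_neg fun h' => h (by rw [← h', ← h']), if_pos rfl, if_neg h]
  norm_num

theorem permVec_of_apply_apply_eq {τ : Equiv.Perm V} {u : V} (h : τ (τ u) = u) (h' : τ u ≠ u) :
    permVec τ s(u, τ u) = 1 := by
  rw [permVec_mk, if_neg h'.symm, if_pos rfl, if_pos h]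
  norm_num

theorem mem_orb_of_mem_support [Fintype V] {G : SimpleGraph V} {τ : Equiv.Perm V} {u v : V}
    (p : G.Walk u v) (hp : ∀ e ∈ p.edges, permVec τ e ≠ 0) : ∀ a ∈ p.support, a ∈ orb τ u := by
  induction p with
  | nil => intro a ha; rw [SimpleGraph.Walk.mem_support_nil_iff] at ha; exact ha ▸ self_mem_orb _ _
  | @cons u u' v h q ih =>
    intro a ha
    rw [SimpleGraph.Walk.support_cons, List.mem_cons] at ha
    rcases ha with rfl | ha
    · exact self_mem_orb _ _
    have hu' : u' ∈ orb τ u := by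
      rcases (permVec_ne_zero (hp s(u, u') (by simp))).2 with h1 | h1
      · exact ⟨1, h1⟩
      · exact orb_symm ⟨1, h1⟩
    exact orb_trans hu' (ih (fun e he => hp e (by simp [he])) a ha)

/-- Only `τ a` and its preimage can be joined to `a` in the support, and a cycle has two neighbours
at `a`. Hence a cycle in `𝒞` is determined by the orbit of any of its vertices. -/
theorem neighborSet_of_mem_oddCycles {G : SimpleGraph V} {τ : Equiv.Perm V} {C : G.Subgraph}
    (hC : C ∈ oddCycles G (permVec τ)) {a : V} (ha : a ∈ C.verts) :
    C.neighborSet a = {τ a, τ.symm a} ∧ τ (τ a) ≠ a := by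
  obtain ⟨v, p, hp, -, hhalf, rfl⟩ := hC
  rw [SimpleGraph.Walk.mem_verts_toSubgraph] at ha
  have h2 := hp.ncard_neighborSet_toSubgraph_eq_two ha
  have hsub : p.toSubgraph.neighborSet a ⊆ {τ a, τ.symm a} := by
    intro b hb
    have hb' : s(a, b) ∈ p.edges := by
      rw [← SimpleGraph.Walk.mem_edges_toSubgraph]; exact hb
    have := hhalf _ hb'
    rcases (permVec_ne_zero (τ := τ) (a := a) (b := b) (by rw [this]; norm_num)).2 with h | h
    · exact Or.inl h.symm
    · exact Or.inr (by rw [Set.mem_singleton_iff, ← h, Equiv.symm_apply_apply])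
  have hpair : ({τ a, τ.symm a} : Set V).ncard ≤ 2 := 
    (Set.ncard_insert_le _ _).trans (by rw [Set.ncard_singleton])
  have heq := Set.eq_of_subset_of_ncard_le hsub (by lia) (Set.toFinite _)
  refine ⟨heq, fun h => ?_⟩
  have h3 : τ a = τ.symm a := by rw [Equiv.eq_symm_apply, h]
  rw [heq, h3, Set.pair_eq_singleton, Set.ncard_singleton] at h2
  lia

variable [Fintype V]

theorem verts_of_mem_oddCycles {G : SimpleGraph V} {τ : Equiv.Perm V} {C : G.Subgraph}
    (hC : C ∈ oddCycles G (permVec τ)) {r : V} (hr : r ∈ C.verts) : C.verts = orb τ r := by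
  refine Set.Subset.antisymm (fun a ha => ?_) ?_
  · obtain ⟨v, p, hp, -, hhalf, rfl⟩ := hC
    rw [SimpleGraph.Walk.mem_verts_toSubgraph] at ha hr
    have h := mem_orb_of_mem_support p fun e he => by rw [hhalf e he]; norm_num
    exact orb_trans (orb_symm (h r hr)) (h a ha)
  · rintro _ ⟨i, rfl⟩
    induction i with
    | zero => exact hr
    | succ i ih =>
      rw [Function.iterate_succ_apply']
      have h := (neighborSet_of_mem_oddCycles hC ih).1
      have h' : τ (τ^[i] r) ∈ C.neighborSet (τ^[i] r) := by rw [h]; exact Or.inl rfl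
      exact C.edge_vert (C.adj_symm h')

theorem eq_of_mem_oddCycles {G : SimpleGraph V} {τ : Equiv.Perm V} {C D : G.Subgraph}
    (hC : C ∈ oddCycles G (permVec τ)) (hD : D ∈ oddCycles G (permVec τ)) {r : V}
    (hrC : r ∈ C.verts) (hrD : r ∈ D.verts) : C = D := by
  have hv : C.verts = D.verts := by
    rw [verts_of_mem_oddCycles hC hrC, verts_of_mem_oddCycles hD hrD]
  refine SimpleGraph.Subgraph.ext hv ?_
  ext a b
  constructor
  · intro h
    have ha := C.edge_vert h
    have h1 : b ∈ C.neighborSet a := h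
    rw [(neighborSet_of_mem_oddCycles hC ha).1, ← (neighborSet_of_mem_oddCycles hD (hv ▸ ha)).1]
      at h1
    exact h1
  · intro h
    have ha := D.edge_vert h
    have h1 : b ∈ D.neighborSet a := h
    rw [(neighborSet_of_mem_oddCycles hD ha).1, ← (neighborSet_of_mem_oddCycles hC (hv ▸ ha)).1]
      at h1
    exact h1

theorem ncard_oddCycles_le {G : SimpleGraph V} {τ : Equiv.Perm V} (R : Finset V)
    (hR : ∀ u, τ (τ u) ≠ u → ∃ r ∈ R, r ∈ orb τ u) :
    (oddCycles G (permVec τ)).ncard ≤ R.card := by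
  have hex : ∀ C ∈ oddCycles G (permVec τ), ∃ r, r ∈ R ∧ r ∈ C.verts := by
    intro C hC
    obtain ⟨v, p, hp, -, hhalf, hCp⟩ := id hC
    have hv : v ∈ C.verts := by rw [hCp]; simp
    obtain ⟨r, hr, hrv⟩ := hR v (neighborSet_of_mem_oddCycles hC hv).2
    exact ⟨r, hr, by rw [verts_of_mem_oddCycles hC hv]; exact hrv⟩
  rcases (oddCycles G (permVec τ)).eq_empty_or_nonempty with h | ⟨C, hC⟩
  · simp [h]
  have : Nonempty V := ⟨(hex C hC).choose⟩
  choose! f hfR hfv using hex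
  rw [← Set.ncard_coe_finset]
  exact Set.ncard_le_ncard_of_injOn f hfR (fun C hC D hD h =>
    eq_of_mem_oddCycles hC hD (hfv C hC) (h ▸ hfv D hD)) (Set.toFinite _)

/-- An odd cycle of a permutation of length at least three is traversed by a cycle of the graph. -/
theorem exists_mem_oddCycles {G : SimpleGraph V} {σ : Equiv.Perm V} (hσ : MovesAlong G σ) {u : V}
    (hu : σ (σ u) ≠ u) {n : ℕ} (hn : Odd n) (hper : σ^[n] u = u) :
    ∃ C ∈ oddCycles G (permVec σ), u ∈ C.verts := by
  set L := Function.minimalPeriod σ u with hL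
  have hLodd : Odd L := odd_minimalPeriod hn hper
  have hLper : σ^[L] u = u := Function.iterate_minimalPeriod
  have hinj : ∀ i j, i < L → j < L → σ^[i] u = σ^[j] u → i = j := fun i j hi hj h =>
    Function.iterate_injOn_Iio_minimalPeriod hi hj h
  have hne : ∀ i, σ (σ (σ^[i] u)) ≠ σ^[i] u := fun i => apply_apply_ne_of_mem_orb hu ⟨i, rfl⟩
  have hadj : ∀ i, G.Adj (σ^[i] u) (σ^[i + 1] u) := fun i => by
    rw [Function.iterate_succ_apply']
    exact (hσ _).resolve_left fun h => hne i (by rw [h, h])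
  have hinj1 : ∀ i j, i < L → j < L → σ^[i + 1] u = σ^[j + 1] u → i = j := fun i j hi hj h => by
    rw [Function.iterate_succ_apply', Function.iterate_succ_apply'] at h
    exact hinj i j hi hj (σ.injective h)
  have hwalk : ∀ k < L, ∃ q : G.Walk (σ^[1] u) (σ^[k + 1] u), q.IsPath ∧ q.length = k ∧
      (∀ a ∈ q.support, ∃ i ≤ k, a = σ^[i + 1] u) ∧
      ∀ e ∈ q.edges, ∃ i < k, e = s(σ^[i + 1] u, σ^[i + 2] u) := by
    intro k
    induction k with
    | zero =>
      intro _
      exact ⟨SimpleGraph.Walk.nil, by simp, rfl, by simp, by simp⟩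
    | succ k ih =>
      intro hk
      obtain ⟨q, h1, h2, h3, h4⟩ := ih (by lia)
      refine ⟨q.concat (hadj (k + 1)), ?_, by rw [SimpleGraph.Walk.length_concat, h2],
        fun a ha => ?_, fun e he => ?_⟩
      · rw [SimpleGraph.Walk.concat_isPath_iff]
        refine ⟨h1, fun hmem => ?_⟩
        obtain ⟨i, hi, h⟩ := h3 _ hmem
        have := hinj1 _ _ hk (by lia) h
        lia
      · rw [SimpleGraph.Walk.support_concat, List.mem_append,
          List.mem_singleton] at ha
        rcases ha with ha | rfl
        · obtain ⟨i, hi, h⟩ := h3 a ha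
          exact ⟨i, by lia, h⟩
        · exact ⟨k + 1, le_rfl, rfl⟩
      · rw [SimpleGraph.Walk.edges_concat, List.concat_eq_append, List.mem_append,
          List.mem_singleton] at he
        rcases he with he | rfl
        · obtain ⟨i, hi, h⟩ := h4 e he
          exact ⟨i, by lia, h⟩
        · exact ⟨k, by lia, rfl⟩
  have hLpos : 0 < L := minimalPeriod_pos σ u
  obtain ⟨q, h1, h2, -, h4⟩ := hwalk (L - 1) (by lia)
  have hend : σ^[L - 1 + 1] u = u := by rw [Nat.sub_add_cancel hLpos, hLper]
  have hadj0 : G.Adj u (σ^[1] u) := hadj 0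
  set p : G.Walk u u := SimpleGraph.Walk.cons hadj0 (q.copy rfl hend) with hp
  refine ⟨p.toSubgraph, ⟨u, p, ?_, ?_, fun e he => ?_, rfl⟩, by simp⟩
  · rw [hp, SimpleGraph.Walk.cons_isCycle_iff]
    refine ⟨(SimpleGraph.Walk.isPath_copy q rfl hend).2 h1, fun hmem => ?_⟩
    rw [SimpleGraph.Walk.edges_copy] at hmem
    obtain ⟨i, hi, h⟩ := h4 _ hmem
    rcases Sym2.eq_iff.1 h with ⟨h5, -⟩ | ⟨h5, h6⟩
    · have := hinj 0 (i + 1) hLpos (by lia) h5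
      lia
    · have := hinj1 0 i hLpos (by lia) h6
      subst this
      exact hu h5.symm
  · rw [hp, SimpleGraph.Walk.length_cons, SimpleGraph.Walk.length_copy, h2,
      Nat.sub_add_cancel hLpos]
    exact hLodd
  · rw [hp, SimpleGraph.Walk.edges_cons, SimpleGraph.Walk.edges_copy, List.mem_cons] at he
    have hhalf : ∀ i, permVec σ s(σ^[i] u, σ^[i + 1] u) = 1 / 2 := fun i => by
      rw [Function.iterate_succ_apply']
      exact permVec_of_apply_apply_ne (hne i)
    rcases he with rfl | he
    · exact hhalf 0
    · obtain ⟨i, -, rfl⟩ := h4 e he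
      exact hhalf (i + 1)

/-- Points of a segment through `permVec τ` share its zeros and its saturated vertices. Values then
alternate between `t` and `1 - t` along a cycle of length at least three, and odd length forces `t =
1/2`. -/
theorem permVec_mem_extremePoints {G : SimpleGraph V} {τ : Equiv.Perm V} (hτ : MovesAlong G τ)
    (hodd : ∀ u, τ (τ u) ≠ u → ∃ n, Odd n ∧ τ^[n] u = u) :
    permVec τ ∈ Set.extremePoints ℝ (fracMatchings G) := by
  classical
  rw [mem_extremePoints_iff_left]
  refine ⟨permVec_mem_fracMatchings hτ, ?_⟩
  rintro x hx z hz ⟨s, t, hs, ht, hst, hxz⟩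
  rw [mem_fracMatchings_iff] at hx hz
  have hval : ∀ e, s * x e + t * z e = permVec τ e := fun e => by
    rw [← hxz]; rfl
  have hzero : ∀ e, permVec τ e = 0 → x e = 0 := by
    intro e he
    have h1 := hval e
    have h2 := mul_nonneg ht.le (hz.2.1 e)
    have h3 := hx.2.1 e
    rw [he] at h1
    nlinarith
  have hdeg : ∀ u, τ u ≠ u → ∑ v, x s(u, v) = 1 := by
    intro u hu
    have h1 : s * ∑ v, x s(u, v) + t * ∑ v, z s(u, v) = 1 := by
      rw [Finset.mul_sum, Finset.mul_sum, ← Finset.sum_add_distrib,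
        Finset.sum_congr rfl fun v _ => hval s(u, v), sum_permVec, if_neg hu]
    have h2 := hx.2.2 u
    have h3 := mul_le_mul_of_nonneg_left (hz.2.2 u) ht.le
    nlinarith
  have hadj : ∀ u v, v ≠ τ u → u ≠ τ v → x s(u, v) = 0 := by
    intro u v h1 h2
    refine hzero _ ?_
    by_contra h
    rcases (permVec_ne_zero h).2 with h3 | h3
    · exact h1 h3.symm
    · exact h2 h3.symm
  have key : ∀ u, τ u ≠ u → x s(u, τ u) = permVec τ s(u, τ u) := by
    intro u hu
    by_cases h2 : τ (τ u) = u
    · rw [permVec_of_apply_apply_eq h2 hu, ← hdeg u hu]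
      refine (Finset.sum_eq_single _ (fun v _ hv => hadj u v hv fun h => hv ?_) (by simp)).symm
      exact τ.injective (by rw [h2, ← h])
    · rw [permVec_of_apply_apply_ne h2]
      have hstep : ∀ v ∈ orb τ u, x s(τ v, τ (τ v)) = 1 - x s(v, τ v) := by
        intro v hv
        have h3 := apply_apply_ne_of_mem_orb h2 hv
        have h4 : τ (τ v) ≠ τ v := fun h => h3 (by rw [h]; exact τ.injective h)
        have h5 := hdeg (τ v) h4
        have h6 : ∑ a, x s(τ v, a) = ∑ a ∈ {τ (τ v), v}, x s(τ v, a) := by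
          refine (Finset.sum_subset (Finset.subset_univ _) fun a _ ha => ?_).symm
          simp only [Finset.mem_insert, Finset.mem_singleton, not_or] at ha
          exact hadj _ _ ha.1 fun h => ha.2 (τ.injective h).symm
        rw [h6, Finset.sum_pair h3, Sym2.eq_swap (a := τ v) (b := v)] at h5
        linarith
      have hiter : ∀ i, x s(τ^[i] u, τ (τ^[i] u)) =
          if Even i then x s(u, τ u) else 1 - x s(u, τ u) := by
        intro i
        induction i with
        | zero => simp
        | succ i ih =>
          rw [Function.iterate_succ_apply', hstep _ ⟨i, rfl⟩, ih]
          by_cases hi : Even i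
          · simp [hi, Nat.even_add_one]
          · simp [hi, Nat.even_add_one]
      obtain ⟨n, hn, hper⟩ := hodd u h2
      have h7 := hiter n
      rw [hper, if_neg (Nat.not_even_iff_odd.2 hn)] at h7
      linarith
  ext e
  by_cases he : permVec τ e = 0
  · rw [he, hzero e he]
  induction e with
  | _ a b =>
    obtain ⟨hab, rfl | rfl⟩ := permVec_ne_zero he
    · exact key a hab.symm
    · rw [Sym2.eq_swap]; exact key b hab

end OddCycles

/-! ### `γ` as a matching defect, and its change under deletion. -/

section Gamma

variable {V : Type*} [Fintype V]

theorem IsOptDual.of_perm {G : SimpleGraph V} {w : Sym2 V → ℝ} {y : V → ℝ} (h0 : ∀ v, 0 ≤ y v)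
    (hc : ∀ u v, G.Adj u v → w s(u, v) ≤ y u + y v) {σ : Equiv.Perm V}
    (hσ : MovesAlong (tightGraph G w y) σ) (hB : ∀ u ∈ {u | 0 < y u}, σ u ≠ u) :
    IsOptDual G w y :=
  ⟨h0, hc, permVec σ, permVec_mem_fracMatchings hσ.of_tightGraph, (fracWeight_permVec h0 hσ hB).ge⟩

theorem IsOptDual.exists_perm {G : SimpleGraph V} {w : Sym2 V → ℝ} {y : V → ℝ}
    (hy : IsOptDual G w y) {x : Sym2 V → ℝ} (hx : x ∈ basicMaxFracMatchings G w) :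
    ∃ σ, x = permVec σ ∧ MovesAlong (tightGraph G w y) σ ∧ ∀ u ∈ {u | 0 < y u}, σ u ≠ u := by
  obtain ⟨σ, hσ, rfl⟩ := exists_perm_of_mem_extremePoints hx.1
  obtain ⟨x₀, hx₀, hle⟩ := hy.attained
  exact ⟨σ, rfl, hy.tight_of_forall_le hσ (hle.trans (hx.2 x₀ hx₀))⟩

/-- A matching of tight edges that misses at most `k` vertices of positive dual value shows that
`γ(G) ≤ k`. -/
theorem IsOptDual.gamma_le {G : SimpleGraph V} {w : Sym2 V → ℝ} {y : V → ℝ}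
    (hy : IsOptDual G w y) {m : Equiv.Perm V} (hm : MovesAlong (tightGraph G w y) m)
    (hmm : ∀ u, m (m u) = u) (R : Finset V) (hR : ∀ u, 0 < y u → m u = u → u ∈ R) :
    gamma G w ≤ R.card := by
  obtain ⟨x, hx⟩ := basicMaxFracMatchings_nonempty G w
  obtain ⟨σ, -, hσ, hσB⟩ := hy.exists_perm hx
  obtain ⟨τ, R', hτ, hτB⟩ := exists_isOddCover_of_involution hσ hσB hm hmm R hR
  have hmem : permVec τ ∈ basicMaxFracMatchings G w :=
    ⟨permVec_mem_extremePoints hτ.moves.of_tightGraph hτ.odd, fun x' hx' => by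
      rw [fracWeight_permVec hy.nonneg hτ.moves hτB]
      exact fracWeight_le_sum hy.nonneg hy.cover hx'⟩
  have hle : gamma G w ≤ (oddCycles G (permVec τ)).ncard := Nat.sInf_le ⟨_, hmem, rfl⟩
  exact hle.trans ((ncard_oddCycles_le R' hτ.hit).trans hτ.card_le)

/-- There is a matching of tight edges that misses at most `γ(G)` vertices of positive dual
value. -/
theorem IsOptDual.exists_matching_le_gamma {G : SimpleGraph V} {w : Sym2 V → ℝ} {y : V → ℝ}
    (hy : IsOptDual G w y) : ∃ (m : Equiv.Perm V) (R : Finset V),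
      MovesAlong (tightGraph G w y) m ∧ (∀ u, m (m u) = u) ∧ (∀ u, 0 < y u → m u = u → u ∈ R) ∧
      R.card ≤ gamma G w := by
  classical
  rcases isEmpty_or_nonempty V with hV | hV
  · exact ⟨1, ∅, fun u => hV.elim u, fun u => hV.elim u, fun u => hV.elim u, by simp⟩
  obtain ⟨x, hx, hγ⟩ := Nat.sInf_mem ((basicMaxFracMatchings_nonempty G w).image
    fun x => (oddCycles G x).ncard)
  obtain ⟨σ, rfl, hσ, hσB⟩ := hy.exists_perm hx
  -- One vertex is chosen on each odd cycle, to be the one missed; the default is never used on a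
  -- cycle.
  let f : G.Subgraph → V := fun C => if h : C.verts.Nonempty then h.some else Classical.arbitrary V
  obtain ⟨m, hm, hmm, hmR⟩ := exists_involution_of_hit {u | 0 < y u}
    (f '' oddCycles G (permVec σ)) σ hσ (fun u hu h => absurd h (hσB u hu))
    (fun u n hu hn hper => by
      obtain ⟨C, hC, huC⟩ := exists_mem_oddCycles hσ.of_tightGraph hu hn hper
      refine ⟨f C, ⟨C, hC, rfl⟩, ?_⟩
      rw [← verts_of_mem_oddCycles hC huC]
      have h : C.verts.Nonempty := ⟨u, huC⟩
      simp only [f, dif_pos h]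
      exact h.some_mem)
  refine ⟨m, (f '' oddCycles G (permVec σ)).toFinset, hm, hmm,
    fun u hu h => Set.mem_toFinset.2 (hmR u hu h), ?_⟩
  rw [← Set.ncard_eq_toFinset_card']
  exact (Set.ncard_image_le (Set.toFinite _)).trans hγ.le

/-- A tight matching that avoids `v` stays tight in `G` for the common dual; only `v` can be newly
missed. -/
theorem gamma_le_gamma_deleteIncidenceSet_add_one (G : SimpleGraph V) (w : Sym2 V → ℝ) (v : V) :
    gamma G w ≤ gamma (G.deleteIncidenceSet v) w + 1 := by
  classical
  obtain ⟨y, hy, hy'⟩ := exists_common_isOptDual G w v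
  obtain ⟨m, R, hm, hmm, hR, hcard⟩ := hy'.exists_matching_le_gamma
  refine (hy.gamma_le (m := m) (hm.mono fun a b h => ?_) hmm (insert v R) fun u hu h => ?_).trans
    ((Finset.card_insert_le _ _).trans (Nat.add_le_add_right hcard 1))
  · have h1 := SimpleGraph.deleteIncidenceSet_adj.1 h.1
    have h2 := h.2
    rw [Function.update_of_ne h1.2.1, Function.update_of_ne h1.2.2] at h2
    exact ⟨h1.1, h2⟩
  · by_cases huv : u = v
    · rw [huv]; exact Finset.mem_insert_self _ _
    · exact Finset.mem_insert_of_mem (hR u (by rwa [Function.update_of_ne huv]) h)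

/-- Dropping the matching edge at `v` exposes only its partner, since the dual value at `v` is now
zero. -/
theorem gamma_deleteIncidenceSet_le_gamma_add_one (G : SimpleGraph V) (w : Sym2 V → ℝ) (v : V) :
    gamma (G.deleteIncidenceSet v) w ≤ gamma G w + 1 := by
  classical
  obtain ⟨y, hy, hy'⟩ := exists_common_isOptDual G w v
  obtain ⟨m, R, hm, hmm, hR, hcard⟩ := hy.exists_matching_le_gamma
  have h1 : (m * Equiv.swap v (m v)) v = v := by simp [hmm]
  have h2 : (m * Equiv.swap v (m v)) (m v) = m v := by simp
  have h3 : ∀ u, u ≠ v → u ≠ m v → (m * Equiv.swap v (m v)) u = m u := fun u hu hu' => by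
    simp [Equiv.swap_apply_of_ne_of_ne hu hu']
  set m' := m * Equiv.swap v (m v)
  have hne : ∀ u, u ≠ v → u ≠ m v → m u ≠ v ∧ m u ≠ m v := fun u hu hu' =>
    ⟨fun h => hu' (by rw [← h, hmm]), fun h => hu (m.injective h)⟩
  refine (hy'.gamma_le (m := m') (fun u => ?_) (fun u => ?_) (insert (m v) R)
    fun u hu h => ?_).trans ((Finset.card_insert_le _ _).trans (Nat.add_le_add_right hcard 1))
  · by_cases hu : u = v
    · rw [hu]; exact Or.inl h1
    by_cases hu' : u = m v
    · rw [hu']; exact Or.inl h2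
    rw [h3 u hu hu']
    refine (hm u).imp_right fun h => ⟨SimpleGraph.deleteIncidenceSet_adj.2
      ⟨h.1, hu, (hne u hu hu').1⟩, ?_⟩
    rw [Function.update_of_ne hu, Function.update_of_ne (hne u hu hu').1]
    exact h.2
  · by_cases hu : u = v
    · rw [hu, h1, h1]
    by_cases hu' : u = m v
    · rw [hu', h2, h2]
    rw [h3 u hu hu', h3 _ (hne u hu hu').1 (hne u hu hu').2, hmm]
  · by_cases hu1 : u = v
    · subst hu1; simp at hu
    by_cases hu' : u = m v
    · rw [hu']; exact Finset.mem_insert_self _ _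
    rw [h3 u hu1 hu'] at h
    rw [Function.update_of_ne hu1] at hu
    exact Finset.mem_insert_of_mem (hR u hu h)

theorem gamma_le_gamma_deleteEdges_singleton (G : SimpleGraph V) (w : Sym2 V → ℝ) (e : Sym2 V) :
    gamma G w ≤ gamma (G.deleteEdges {e}) w + 2 := by
  induction e with
  | _ a b =>
    have h : (G.deleteEdges {s(a, b)}).deleteIncidenceSet a = G.deleteIncidenceSet a := by
      ext u v
      simp only [SimpleGraph.deleteIncidenceSet_adj, SimpleGraph.deleteEdges_adj,
        Set.mem_singleton_iff, Sym2.eq_iff]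
      tauto
    have h1 := gamma_le_gamma_deleteIncidenceSet_add_one G w a
    have h2 := gamma_deleteIncidenceSet_le_gamma_add_one (G.deleteEdges {s(a, b)}) w a
    rw [h] at h2
    lia

theorem gamma_le_gamma_deleteEdges (G : SimpleGraph V) (w : Sym2 V → ℝ) (F : Finset (Sym2 V)) :
    gamma G w ≤ gamma (G.deleteEdges (F : Set (Sym2 V))) w + 2 * F.card := by
  classical
  induction F using Finset.induction_on with
  | empty => simp
  | insert e F he ih =>
    have h := gamma_le_gamma_deleteEdges_singleton (G.deleteEdges (F : Set (Sym2 V))) w e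
    rw [SimpleGraph.deleteEdges_deleteEdges, Set.union_singleton, ← Finset.coe_insert] at h
    rw [Finset.card_insert_of_notMem he]
    lia

end Gamma

/-! ### Matchings as involutions; stability and `γ = 0`. -/

section Stability

variable {V : Type*} [Fintype V]

theorem fracWeight_permVec_eq_subgraphWeight {G : SimpleGraph V} (w : Sym2 V → ℝ)
    {m : Equiv.Perm V} (hmm : ∀ u, m (m u) = u) {M : G.Subgraph}
    (hM : ∀ u v, M.Adj u v ↔ u ≠ v ∧ m u = v) :
    fracWeight G w (permVec m) = subgraphWeight G w M := by
  classical
  unfold fracWeight subgraphWeight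
  rw [Finset.sum_filter]
  refine Finset.sum_congr rfl fun e _ => ?_
  induction e with
  | _ a b =>
    have h : m b = a ↔ m a = b := ⟨fun h => by rw [← h, hmm], fun h => by rw [← h, hmm]⟩
    rw [permVec_mk, SimpleGraph.Subgraph.mem_edgeSet, hM]
    by_cases hab : a = b
    · simp [hab]
    · by_cases hm : m a = b <;> simp [hab, h, hm]

omit [Fintype V] in
theorem exists_involution_of_isMatching {G : SimpleGraph V} {M : G.Subgraph} (hM : M.IsMatching) :
    ∃ m : Equiv.Perm V, MovesAlong G m ∧ (∀ u, m (m u) = u) ∧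
      ∀ u v, M.Adj u v ↔ u ≠ v ∧ m u = v := by
  classical
  have hex : ∀ u, ∃ v, (u ∈ M.verts → M.Adj u v) ∧ (u ∉ M.verts → v = u) := by
    intro u
    by_cases hu : u ∈ M.verts
    · obtain ⟨v, hv, -⟩ := hM hu
      exact ⟨v, fun _ => hv, fun h => absurd hu h⟩
    · exact ⟨u, fun h => absurd h hu, fun _ => rfl⟩
  choose f hf1 hf2 using hex
  have hinv : Function.Involutive f := by
    intro u
    by_cases hu : u ∈ M.verts
    · have h := hf1 u hu
      exact hM.eq_of_adj_left (hf1 _ (M.edge_vert h.symm)) h.symm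
    · rw [hf2 u hu, hf2 u hu]
  refine ⟨hinv.toPerm, fun u => ?_, hinv, fun u v => ⟨fun h => ⟨h.ne, ?_⟩, fun h => ?_⟩⟩
  · by_cases hu : u ∈ M.verts
    · exact Or.inr (hf1 u hu).adj_sub
    · exact Or.inl (hf2 u hu)
  · exact hM.eq_of_adj_left (hf1 u (M.edge_vert h)) h
  · have h2 : f u = v := h.2
    by_cases hu : u ∈ M.verts
    · exact h2 ▸ hf1 u hu
    · exact absurd ((hf2 u hu).symm.trans h2) h.1

omit [Fintype V] in
theorem exists_isMatching_of_involution {G : SimpleGraph V} {m : Equiv.Perm V}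
    (hm : MovesAlong G m) (hmm : ∀ u, m (m u) = u) :
    ∃ M : G.Subgraph, M.IsMatching ∧ ∀ u v, M.Adj u v ↔ u ≠ v ∧ m u = v := by
  refine ⟨⟨{u | m u ≠ u}, fun u v => u ≠ v ∧ m u = v, ?_, ?_, ⟨?_⟩⟩, ?_, fun _ _ => Iff.rfl⟩
  · rintro u v ⟨h1, rfl⟩
    exact (hm u).resolve_left h1.symm
  · rintro u v ⟨h1, rfl⟩
    exact h1.symm
  · rintro u v ⟨h1, rfl⟩
    exact ⟨h1.symm, hmm u⟩
  · intro u hu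
    exact ⟨m u, ⟨Ne.symm hu, rfl⟩, fun v hv => hv.2.symm⟩

theorem finite_setOf_subgraphWeight (G : SimpleGraph V) (w : Sym2 V → ℝ) :
    {r | ∃ M : G.Subgraph, M.IsMatching ∧ subgraphWeight G w M = r}.Finite :=
  (Set.finite_range (subgraphWeight G w)).subset fun _ ⟨M, _, h⟩ => ⟨M, h⟩

theorem nonempty_setOf_subgraphWeight (G : SimpleGraph V) (w : Sym2 V → ℝ) :
    {r | ∃ M : G.Subgraph, M.IsMatching ∧ subgraphWeight G w M = r}.Nonempty :=
  ⟨_, ⊥, fun _ h => absurd h (by simp), rfl⟩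

theorem IsOptDual.nuFrac_eq {G : SimpleGraph V} {w : Sym2 V → ℝ} {y : V → ℝ}
    (hy : IsOptDual G w y) : nuFrac G w = ∑ v, y v := by
  obtain ⟨x, hx, hle⟩ := hy.attained
  have hub : ∀ r ∈ fracWeight G w '' fracMatchings G, r ≤ ∑ v, y v := by
    rintro _ ⟨x, hx, rfl⟩
    exact fracWeight_le_sum hy.nonneg hy.cover hx
  exact le_antisymm (csSup_le ⟨_, x, hx, rfl⟩ hub) (hle.trans (le_csSup ⟨_, hub⟩ ⟨x, hx, rfl⟩))

/-- A maximum matching attains the dual value, so it is tight and misses no vertex of positive dual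
value. -/
theorem gamma_eq_zero_of_isStable {G : SimpleGraph V} {w : Sym2 V → ℝ} (h : IsStable G w) :
    gamma G w = 0 := by
  obtain ⟨y, hy⟩ := exists_isOptDual G w
  obtain ⟨M, hM, hMw⟩ :=
    (nonempty_setOf_subgraphWeight G w).csSup_mem (finite_setOf_subgraphWeight G w)
  obtain ⟨m, hm, hmm, hMm⟩ := exists_involution_of_isMatching hM
  obtain ⟨hmT, hmB⟩ := hy.tight_of_forall_le hm (by
    rw [fracWeight_permVec_eq_subgraphWeight w hmm hMm, hMw, ← hy.nuFrac_eq]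
    exact h.ge)
  have := hy.gamma_le hmT hmm ∅ fun u hu hfix => absurd hfix (hmB u hu)
  simpa using this

theorem isStable_of_involution {G : SimpleGraph V} {w : Sym2 V → ℝ} {y : V → ℝ}
    (h0 : ∀ v, 0 ≤ y v) (hc : ∀ u v, G.Adj u v → w s(u, v) ≤ y u + y v) {m : Equiv.Perm V}
    (hm : MovesAlong (tightGraph G w y) m) (hmm : ∀ u, m (m u) = u)
    (hB : ∀ u ∈ {u | 0 < y u}, m u ≠ u) : IsStable G w := by
  have hy := IsOptDual.of_perm h0 hc hm hB
  unfold IsStable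
  rw [hy.nuFrac_eq]
  refine le_antisymm (csSup_le (nonempty_setOf_subgraphWeight G w) ?_)
    (le_csSup (finite_setOf_subgraphWeight G w).bddAbove ?_)
  · rintro _ ⟨M, hM, rfl⟩
    obtain ⟨m', hm', hmm', hMm⟩ := exists_involution_of_isMatching hM
    rw [← fracWeight_permVec_eq_subgraphWeight w hmm' hMm]
    exact fracWeight_le_sum h0 hc (permVec_mem_fracMatchings hm')
  · obtain ⟨M, hM, hMm⟩ := exists_isMatching_of_involution hm.of_tightGraph hmm
    refine ⟨M, hM, ?_⟩
    rw [← fracWeight_permVec_eq_subgraphWeight w hmm hMm, fracWeight_permVec h0 hm hB]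

theorem IsEdgeStabilizer.gamma_le {G : SimpleGraph V} {w : Sym2 V → ℝ} {F : Finset (Sym2 V)}
    (hF : IsEdgeStabilizer G w F) : gamma G w ≤ 2 * F.card := by
  have := gamma_le_gamma_deleteEdges G w F
  rwa [gamma_eq_zero_of_isStable hF.2, zero_add] at this

end Stability

/-! ### Two triangles where one edge suffices although `γ = 2`. -/

section Example

/-- Two triangles `012` and `345`, joined by the path `0673`. -/
def twoTriangles : SimpleGraph (Fin 8) :=
  SimpleGraph.fromRel fun u v => (u, v) ∈
    [((0 : Fin 8), (1 : Fin 8)), (0, 2), (1, 2), (3, 4), (3, 5), (4, 5), (6, 7), (0, 6), (3, 7)]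

instance : DecidableRel twoTriangles.Adj := by
  unfold twoTriangles
  infer_instance

/-- Weight two on the triangles and weight one on the path. -/
noncomputable def twoTrianglesWeight (e : Sym2 (Fin 8)) : ℝ := if 6 ∈ e ∨ 7 ∈ e then 1 else 2

/-- The vector with value one on the triangles and value `t` at the inner vertices of the path. -/
noncomputable def twoTrianglesDual (t : ℝ) (u : Fin 8) : ℝ := if u = 6 ∨ u = 7 then t else 1

theorem twoTrianglesWeight_pos (e : Sym2 (Fin 8)) : 0 < twoTrianglesWeight e := by
  unfold twoTrianglesWeight
  split_ifs <;> norm_num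

theorem twoTrianglesDual_nonneg {t : ℝ} (ht : 0 ≤ t) (u : Fin 8) : 0 ≤ twoTrianglesDual t u := by
  unfold twoTrianglesDual
  split_ifs
  exacts [ht, zero_le_one]

/-- Neither or both of the vertices are among `6` and `7`. -/
def IsInner (u v : Fin 8) : Prop := (u = 6 ∨ u = 7) ↔ (v = 6 ∨ v = 7)

instance : DecidableRel IsInner := fun u v => by
  unfold IsInner
  infer_instance

theorem tight_half_iff (u v : Fin 8) :
    twoTrianglesWeight s(u, v) = twoTrianglesDual (1 / 2) u + twoTrianglesDual (1 / 2) v ↔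
      IsInner u v := by
  unfold twoTrianglesWeight twoTrianglesDual IsInner
  simp only [Sym2.mem_iff]
  by_cases hu : u = 6 ∨ u = 7 <;> by_cases hv : v = 6 ∨ v = 7
  · rw [if_pos (by tauto), if_pos hu, if_pos hv]; norm_num [hu, hv]
  · rw [if_pos (by tauto), if_pos hu, if_neg hv]; norm_num [hu, hv]
  · rw [if_pos (by tauto), if_neg hu, if_pos hv]; norm_num [hu, hv]
  · rw [if_neg (by tauto), if_neg hu, if_neg hv]; norm_num [hu, hv]

theorem cover_half (u v : Fin 8) :
    twoTrianglesWeight s(u, v) ≤ twoTrianglesDual (1 / 2) u + twoTrianglesDual (1 / 2) v := by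
  unfold twoTrianglesWeight twoTrianglesDual
  simp only [Sym2.mem_iff]
  by_cases hu : u = 6 ∨ u = 7 <;> by_cases hv : v = 6 ∨ v = 7
  · rw [if_pos (by tauto), if_pos hu, if_pos hv]; norm_num
  · rw [if_pos (by tauto), if_pos hu, if_neg hv]; norm_num
  · rw [if_pos (by tauto), if_neg hu, if_pos hv]; norm_num
  · rw [if_neg (by tauto), if_neg hu, if_neg hv]; norm_num

theorem tight_zero (u v : Fin 8) (h : ¬((u = 6 ∨ u = 7) ∧ (v = 6 ∨ v = 7))) :
    twoTrianglesWeight s(u, v) = twoTrianglesDual 0 u + twoTrianglesDual 0 v := by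
  unfold twoTrianglesWeight twoTrianglesDual
  simp only [Sym2.mem_iff]
  by_cases hu : u = 6 ∨ u = 7 <;> by_cases hv : v = 6 ∨ v = 7
  · exact absurd ⟨hu, hv⟩ h
  · rw [if_pos (by tauto), if_pos hu, if_neg hv]; norm_num
  · rw [if_pos (by tauto), if_neg hu, if_pos hv]; norm_num
  · rw [if_neg (by tauto), if_neg hu, if_neg hv]; norm_num

theorem movesAlong_tight_half {σ : Equiv.Perm (Fin 8)}
    (h : ∀ u, σ u = u ∨ twoTriangles.Adj u (σ u) ∧ IsInner u (σ u)) :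
    MovesAlong (tightGraph twoTriangles twoTrianglesWeight (twoTrianglesDual (1 / 2))) σ :=
  fun u => (h u).imp_right fun h => ⟨h.1, (tight_half_iff _ _).2 h.2⟩

/-- With `t = 1/2` the tight edges are those of the triangles and the middle edge `67`, so the
triangles cannot help each other and each leaves a vertex unmatched. -/
theorem isOptDual_half :
    IsOptDual twoTriangles twoTrianglesWeight (twoTrianglesDual (1 / 2)) := by
  have h : ∀ u, twoTriangles.Adj u ((c[0, 1, 2] * c[3, 4, 5] * c[6, 7] : Equiv.Perm (Fin 8)) u) ∧
      IsInner u ((c[0, 1, 2] * c[3, 4, 5] * c[6, 7] : Equiv.Perm (Fin 8)) u) := by decide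
  exact IsOptDual.of_perm (twoTrianglesDual_nonneg (by norm_num)) (fun u v _ => cover_half u v)
    (movesAlong_tight_half fun u => Or.inr (h u)) fun u _ => (h u).1.ne'

theorem exists_fixed_of_three {m : Fin 8 → Fin 8} (hmm : ∀ u, m (m u) = u) {a b c : Fin 8}
    (hab : a ≠ b) (hac : a ≠ c) (hbc : b ≠ c)
    (h : ∀ u, u = a ∨ u = b ∨ u = c → m u = a ∨ m u = b ∨ m u = c) :
    ∃ u, (u = a ∨ u = b ∨ u = c) ∧ m u = u := by
  have ha := h a (by simp)
  have hb := h b (by simp)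
  have hc := h c (by simp)
  have ha' := hmm a
  have hb' := hmm b
  have hc' := hmm c
  grind

theorem gamma_twoTriangles : gamma twoTriangles twoTrianglesWeight = 2 := by
  have hy := isOptDual_half
  refine le_antisymm ?_ ?_
  · have hm : ∀ u, (c[1, 2] * c[4, 5] * c[6, 7] : Equiv.Perm (Fin 8)) u = u ∨
        twoTriangles.Adj u ((c[1, 2] * c[4, 5] * c[6, 7] : Equiv.Perm (Fin 8)) u) ∧
        IsInner u ((c[1, 2] * c[4, 5] * c[6, 7] : Equiv.Perm (Fin 8)) u) := by decide
    have hfix : ∀ u, (c[1, 2] * c[4, 5] * c[6, 7] : Equiv.Perm (Fin 8)) u = u →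
        u ∈ ({0, 3} : Finset (Fin 8)) := by decide
    exact hy.gamma_le (movesAlong_tight_half hm) (by decide) {0, 3} fun u _ h => hfix u h
  · obtain ⟨m, R, hm, hmm, hR, hcard⟩ := hy.exists_matching_le_gamma
    refine le_trans ?_ hcard
    have hpos : ∀ u, 0 < twoTrianglesDual (1 / 2) u := fun u => by
      unfold twoTrianglesDual
      split_ifs <;> norm_num
    have hm' : ∀ u, m u = u ∨ twoTriangles.Adj u (m u) ∧ IsInner u (m u) := fun u =>
      (hm u).imp_right fun h => ⟨h.1, (tight_half_iff _ _).1 h.2⟩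
    have h1 : ∀ u v : Fin 8, twoTriangles.Adj u v ∧ IsInner u v → (u = 0 ∨ u = 1 ∨ u = 2) →
        (v = 0 ∨ v = 1 ∨ v = 2) := by decide
    have h2 : ∀ u v : Fin 8, twoTriangles.Adj u v ∧ IsInner u v → (u = 3 ∨ u = 4 ∨ u = 5) →
        (v = 3 ∨ v = 4 ∨ v = 5) := by decide
    obtain ⟨a, ha, hfa⟩ := exists_fixed_of_three hmm (a := 0) (b := 1) (c := 2) (by decide)
      (by decide) (by decide) fun u hu => (hm' u).elim (fun h => by rwa [h]) fun h => h1 u _ h hu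
    obtain ⟨b, hb, hfb⟩ := exists_fixed_of_three hmm (a := 3) (b := 4) (c := 5) (by decide)
      (by decide) (by decide) fun u hu => (hm' u).elim (fun h => by rwa [h]) fun h => h2 u _ h hu
    have hab : a ≠ b := by
      rcases ha with rfl | rfl | rfl <;> rcases hb with rfl | rfl | rfl <;> decide
    exact Finset.one_lt_card.2 ⟨a, hR a (hpos a) hfa, b, hR b (hpos b) hfb, hab⟩

/-- Without `67` the dual with `t = 0` is feasible and the perfect matching `06`, `12`, `37`, `45`
is tight. -/
theorem isStable_twoTriangles_deleteEdges :
    IsStable (twoTriangles.deleteEdges {s(6, 7)}) twoTrianglesWeight := by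
  have hadj : ∀ u v, (twoTriangles.deleteEdges {s(6, 7)}).Adj u v →
      ¬((u = 6 ∨ u = 7) ∧ (v = 6 ∨ v = 7)) := by
    intro u v h
    rw [SimpleGraph.deleteEdges_adj, Set.mem_singleton_iff, Sym2.eq_iff] at h
    have := h.1.ne
    grind
  have hm : ∀ u, twoTriangles.Adj u
      ((c[0, 6] * c[1, 2] * c[3, 7] * c[4, 5] : Equiv.Perm (Fin 8)) u) ∧
      ¬ s(u, (c[0, 6] * c[1, 2] * c[3, 7] * c[4, 5] : Equiv.Perm (Fin 8)) u) = s(6, 7) := by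
    decide
  refine isStable_of_involution (y := twoTrianglesDual 0)
    (m := c[0, 6] * c[1, 2] * c[3, 7] * c[4, 5]) (twoTrianglesDual_nonneg le_rfl)
    (fun u v h => (tight_zero u v (hadj u v h)).le) (fun u => Or.inr ?_) (by decide)
    (fun u _ => (hm u).1.ne')
  have h : (twoTriangles.deleteEdges {s(6, 7)}).Adj u
      ((c[0, 6] * c[1, 2] * c[3, 7] * c[4, 5] : Equiv.Perm (Fin 8)) u) :=
    SimpleGraph.deleteEdges_adj.2 ⟨(hm u).1, (hm u).2⟩
  exact ⟨h, tight_zero _ _ (hadj _ _ h)⟩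

theorem isMinEdgeStabilizer_twoTriangles :
    IsMinEdgeStabilizer twoTriangles twoTrianglesWeight {s(6, 7)} := by
  refine ⟨⟨?_, ?_⟩, fun F hF => ?_⟩
  · have h : twoTriangles.Adj 6 7 := by decide
    simpa using h
  · rw [Finset.coe_singleton]
    exact isStable_twoTriangles_deleteEdges
  · have := hF.gamma_le
    rw [gamma_twoTriangles] at this
    rw [Finset.card_singleton]
    lia

end Example

end WeightedMatching

theorem mainTheorem6 :
    (∀ (V : Type*) [Fintype V] (G : SimpleGraph V) (w : Sym2 V → ℝ),
      (∀ e ∈ G.edgeSet, 0 ≤ w e) →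
        (∀ e ∈ G.edgeSet,
          (WeightedMatching.gamma (G.deleteEdges {e}) w : ℤ) ≥ WeightedMatching.gamma G w - 2) ∧
        (∀ F : Finset (Sym2 V), WeightedMatching.IsEdgeStabilizer G w F →
          (F.card : ℤ) ≥ ⌈(WeightedMatching.gamma G w : ℝ) / 2⌉)) ∧
    (∃ (G : SimpleGraph (Fin 8)) (w : Sym2 (Fin 8) → ℝ) (e : Sym2 (Fin 8)),
      (∀ e' ∈ G.edgeSet, 0 < w e') ∧
        WeightedMatching.gamma G w = 2 ∧
        WeightedMatching.IsMinEdgeStabilizer G w {e}) := by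
  refine ⟨fun V _ G w _ => ⟨fun e _ => ?_, fun F hF => ?_⟩,
    WeightedMatching.twoTriangles, WeightedMatching.twoTrianglesWeight, s(6, 7),
    fun e _ => WeightedMatching.twoTrianglesWeight_pos e,
    WeightedMatching.gamma_twoTriangles, WeightedMatching.isMinEdgeStabilizer_twoTriangles⟩
  · have := WeightedMatching.gamma_le_gamma_deleteEdges_singleton G w e
    lia
  · have h : (WeightedMatching.gamma G w : ℝ) ≤ 2 * F.card := by exact_mod_cast hF.gamma_le
    refine Int.ceil_le.2 ?_
    push_cast
    linarith
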